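/- Let $p$ be a prime, $\mathbf{F}_q$ a finite field with $q=p^n$ elements, $\mathbf{Q}_q$ the unramified extension of $\mathbf{Q}_p$ of degree $n$, $\mathbf{Z}_q$ its ring of integers and $\bar{\mathbf{Q}}_q$ an algebraic closure of $\mathbf{Q}_q$. Let $Q\in\mathbf{F}_q[x,y]$ be irreducible, monic in $y$ of degree $d_x$, and separable as a polynomial in $y$ over $\mathbf{F}_q(x)$. Let $\mathcal{Q}\in\mathbf{Z}_q[x,y]$ be a lift of $Q$ that is monic in $y$ and has the same monomials in its support as $Q$. Let $\Delta\in\mathbf{Z}_q[x]$ be the discriminant of $\mathcal{Q}$ with respect to $y$, let $r=\Delta/\gcd(\Delta,\frac{d\Delta}{dx})$ (well defined up to units of $\mathbf{Z}_q$), and put $\mathcal{S}=\mathbf{Z}_q[x,1/r]$, $\mathcal{R}=\mathbf{Z}_q[x,1/r,y]/(\mathcal{Q})$. Assume the following. 1. There are a smooth proper curve $\mathcal{X}$ over $\mathbf{Z}_q$ and a smooth relative divisor $\mathcal{D}_{\mathcal{X}}$ on $\mathcal{X}$ with $\operatorname{Spec}\mathcal{R}=\mathcal{X}\setminus\mathcal{D}_{\mathcal{X}}$,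 and there is a smooth relative divisor $\mathcal{D}_{\mathbf{P}^1}$ on $\mathbf{P}^1_{\mathbf{Z}_q}$ with $\operatorname{Spec}\mathcal{S}=\mathbf{P}^1_{\mathbf{Z}_q}\setminus\mathcal{D}_{\mathbf{P}^1}$ (a smooth relative divisor being a closed subscheme that is étale over $\mathbf{Z}_q$). 2. The zero locus of $\mathcal{Q}$ in $\mathbf{A}^2_{\mathbf{Q}_q}$ is smooth. 3. $W^\infty\in GL_{d_x}(\mathbf{Z}_q[x,x^{-1}])$ is a matrix such that the elements $b^\infty_j=\sum_{i=0}^{d_x-1}W^\infty_{i+1,j+1}y^i$, $0\le j\le d_x-1$, form an integral basis of the function field $\mathbf{Q}_q(x,y)=\mathbf{Q}_q(x)[y]/(\mathcal{Q})$ over $\mathbf{Q}_q[x^{-1}]$, that is, a basis of the integral closure of $\mathbf{Q}_q[x^{-1}]$ in $\mathbf{Q}_q(x,y)$ as a module over $\mathbf{Q}_q[x^{-1}]$. Then there are unique $d_x\times d_x$ matrices $G$ and $G^\infty$ over $\mathbf{Q}_q(x)$ such that, in the module of Kähler differentials of $\mathbf{Q}_q(x,y)$ over $\mathbf{Q}_q$,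 $$d(y^j)=\sum_{i=0}^{d_x-1}G_{i+1,j+1}\,y^i\,dx,\qquad db^\infty_j=\sum_{i=0}^{d_x-1}G^\infty_{i+1,j+1}\,b^\infty_i\,dx\qquad(0\le j\le d_x-1).$$ For every $x_0\in\bar{\mathbf{Q}}_q$ the matrix $G\,dx$ has at most a simple pole at $x_0$, and every exponent of $G\,dx$ at $x_0$, i.e. every eigenvalue in $\bar{\mathbf{Q}}_q$ of the residue matrix $(x-x_0)G|_{x=x_0}$, lies in $\mathbf{Q}\cap\mathbf{Z}_p$ and in the interval $[0,1)$. Likewise $G^\infty dx$ has at most a simple pole at $x=\infty$, and every exponent of $G^\infty dx$ at $\infty$, i.e. every eigenvalue in $\bar{\mathbf{Q}}_q$ of the residue matrix $tH|_{t=0}$, where $t=1/x$ and $H(t)\,dt=G^\infty(x)\,dx$, lies in $\mathbf{Q}\cap\mathbf{Z}_p$ and in $[0,1)$. -/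

import Mathlib

open Polynomial
open scoped LaurentPolynomial

universe u

noncomputable section

namespace GaussManin

/-! ### The base rings

For a finite field `k` with `q = p ^ n` elements, `ℤ_q` is the ring of `p`-typical Witt vectors of
`k`, which is the ring of integers of the unramified extension `ℚ_q` of `ℚ_p` of degree `n`. -/

section Base

variable (p : ℕ) [Fact p.Prime] (k : Type u) [Field k] [CharP k p]

/-- The ring `ℤ_q`. -/
abbrev Zq : Type u := WittVector p k

/-- The field `ℚ_q`. -/
abbrev Qq : Type u := FractionRing (WittVector p k)

/-- An algebraic closure of `ℚ_q`. -/
abbrev QqBar : Type u := AlgebraicClosure (Qq p k)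

/-- The inclusion of `ℤ_q[x]` into the rational function field `ℚ_q(x)`. -/
def polyToRat : (Zq p k)[X] →+* RatFunc (Qq p k) :=
  (algebraMap (Qq p k)[X] (RatFunc (Qq p k))).comp
    (Polynomial.mapRingHom (algebraMap (Zq p k) (Qq p k)))

/-- The inclusion of `ℤ_q[x, x⁻¹]` into the rational function field `ℚ_q(x)`. -/
def laurentToRat : (Zq p k)[T;T⁻¹] →+* RatFunc (Qq p k) :=
  LaurentPolynomial.eval₂
    ((algebraMap (Qq p k) (RatFunc (Qq p k))).comp (algebraMap (Zq p k) (Qq p k)))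
    (Units.mk0 RatFunc.X RatFunc.X_ne_zero)

end Base

/-! ### The lift of the plane equation

A polynomial in `x` and `y` is an element of `R[X][X]`; the outer variable is `y`, the inner
variable is `x`. -/

section Lift

variable {p : ℕ} [Fact p.Prime] {k : Type u} [Field k] [CharP k p]

/-- `F ∈ ℤ_q[x, y]` is a lift of `Q ∈ 𝔽_q[x, y]` that is monic in `y` and has the same monomials
in its support as `Q`. -/
structure IsMonicLift (Q : k[X][X]) (F : (Zq p k)[X][X]) : Prop where
  reduction : F.map (Polynomial.mapRingHom (WittVector.constantCoeff : Zq p k →+* k)) = Q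
  monic : F.Monic
  support : ∀ i j : ℕ, (F.coeff j).coeff i ≠ 0 ↔ (Q.coeff j).coeff i ≠ 0

/-- `r = Δ / gcd (Δ, dΔ/dx)`, for some choice `g` of the greatest common divisor, which is only
determined up to units. -/
def IsSquarefreePart {R : Type*} [CommRing R] (Δ r : R[X]) : Prop :=
  ∃ g : R[X], g ∣ Δ ∧ g ∣ derivative Δ ∧ (∀ h : R[X], h ∣ Δ → h ∣ derivative Δ → h ∣ g) ∧
    Δ = g * r

/-- The ring `𝓡 = ℤ_q[x, 1/r, y] / (F)`. -/
abbrev RingR (F : (Zq p k)[X][X]) (r : (Zq p k)[X]) : Type u :=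
  AdjoinRoot (F.map (algebraMap (Zq p k)[X] (Localization.Away r)))

/-- The function field `ℚ_q(x, y) = ℚ_q(x)[y] / (F)`. -/
abbrev FunField (F : (Zq p k)[X][X]) : Type u :=
  AdjoinRoot (F.map (polyToRat p k))

/-- The zero locus of `F` in the affine plane over `ℚ_q` is smooth: at no geometric point of it do
both partial derivatives of `F` vanish. -/
def SmoothZeroLocus (F : (Zq p k)[X][X]) : Prop :=
  ∀ a b : QqBar p k,
    let F' : (QqBar p k)[X][X] :=
      F.map (Polynomial.mapRingHom (algebraMap (Zq p k) (QqBar p k)))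
    F'.evalEval a b = 0 →
      (derivative F').evalEval a b ≠ 0 ∨ (derivative (F'.eval (C b))).eval a ≠ 0

end Lift

/-! ### Good reduction of the pair of curves -/

/-- A closed subscheme of the projective line over `R`, given by its ideals in the two standard
charts, with coordinates `x` and `t = 1/x`, which agree in `R[x, x⁻¹]`. -/
structure ClosedInP1 (R : Type*) [CommRing R] where
  idealX : Ideal R[X]
  idealT : Ideal R[X]
  glue : idealX.map (Polynomial.toLaurent : R[X] →+* R[T;T⁻¹]) =
    idealT.map ((LaurentPolynomial.invert : R[T;T⁻¹] ≃ₐ[R] R[T;T⁻¹]).toRingHom.comp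
      (Polynomial.toLaurent : R[X] →+* R[T;T⁻¹]))

/-- A closed subscheme of the projective line over `R` is a smooth relative divisor when it is
étale, that is, smooth of relative dimension `0`, over `R`. -/
def ClosedInP1.IsSmoothDivisor {R : Type*} [CommRing R] (D : ClosedInP1 R) : Prop :=
  Algebra.Etale R (R[X] ⧸ D.idealX) ∧ Algebra.Etale R (R[X] ⧸ D.idealT)

/-- The open subset `Spec R[x, 1/r]` of the projective line over `R` is the complement of `D`.
In the chart with coordinate `t = 1/x`, the complement of this open subset is the zero locus
of `t * r.reverse (t)`. -/
def ClosedInP1.ComplementIs {R : Type*} [CommRing R] (D : ClosedInP1 R) (r : R[X]) : Prop :=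
  PrimeSpectrum.zeroLocus (D.idealX : Set R[X]) = PrimeSpectrum.zeroLocus {r} ∧
  PrimeSpectrum.zeroLocus (D.idealT : Set R[X]) = PrimeSpectrum.zeroLocus {X * r.reverse}

open AlgebraicGeometry CategoryTheory in
/-- The spectrum of the `R`-algebra `A` is the complement of a smooth relative divisor in a smooth
proper curve over `R`. -/
def IsComplementOfSmoothDivisor (R A : Type u) [CommRing R] [CommRing A] [Algebra R A] : Prop :=
  ∃ (𝒳 D : Scheme.{u}) (f : 𝒳 ⟶ Spec (CommRingCat.of R)) (i : D ⟶ 𝒳)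
    (j : Spec (CommRingCat.of A) ⟶ 𝒳),
    IsProper f ∧ SmoothOfRelativeDimension 1 f ∧
    IsClosedImmersion i ∧ Etale (i ≫ f) ∧
    IsOpenImmersion j ∧ j ≫ f = Spec.map (CommRingCat.ofHom (algebraMap R A)) ∧
    Set.range j = (Set.range i)ᶜ

/-- The good reduction assumption: `Spec 𝓡` and `Spec 𝓢`, with `𝓢 = ℤ_q[x, 1/r]`, are complements
of smooth relative divisors on a smooth proper curve over `ℤ_q` and on the projective line over
`ℤ_q`, respectively. -/
structure GoodLift {p : ℕ} [Fact p.Prime] {k : Type u} [Field k] [CharP k p]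
    (F : (Zq p k)[X][X]) (r : (Zq p k)[X]) : Prop where
  curve : IsComplementOfSmoothDivisor (Zq p k) (RingR F r)
  line : ∃ D : ClosedInP1 (Zq p k), D.IsSmoothDivisor ∧ D.ComplementIs r

/-! ### Connection matrices -/

section Connection

variable {p : ℕ} [Fact p.Prime] {k : Type u} [Field k] [CharP k p]

/-- The family `1, y, …, y ^ (d - 1)` of elements of `ℚ_q(x, y)`, with `d` the degree of `F`
in `y`. -/
def powerFamily (F : (Zq p k)[X][X]) : Fin F.natDegree → FunField F :=
  fun j => AdjoinRoot.root (F.map (polyToRat p k)) ^ (j : ℕ)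

/-- The family `b_j = ∑ i, W i j * y ^ i` of elements of `ℚ_q(x, y)`. -/
def infinityFamily (F : (Zq p k)[X][X])
    (W : GL (Fin F.natDegree) (Zq p k)[T;T⁻¹]) : Fin F.natDegree → FunField F :=
  fun j => ∑ i, laurentToRat p k (W.val i j) • powerFamily F i

/-- The subring `ℚ_q[x⁻¹]` of `ℚ_q(x, y)`. -/
abbrev invXSubalgebra (F : (Zq p k)[X][X]) : Subalgebra (Qq p k) (FunField F) :=
  Algebra.adjoin (Qq p k)
    {algebraMap (RatFunc (Qq p k)) (FunField F) (RatFunc.X : RatFunc (Qq p k))⁻¹}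

/-- `b` is an integral basis of `ℚ_q(x, y)` over `ℚ_q[x⁻¹]`, that is, a basis of the integral
closure of `ℚ_q[x⁻¹]` in `ℚ_q(x, y)` as a `ℚ_q[x⁻¹]`-module. -/
def IsIntegralBasisAtInfinity (F : (Zq p k)[X][X])
    (b : Fin F.natDegree → FunField F) : Prop :=
  LinearIndependent (invXSubalgebra F) b ∧
  Submodule.span (invXSubalgebra F) (Set.range b) =
    Subalgebra.toSubmodule (integralClosure (invXSubalgebra F) (FunField F))

/-- `G dx` is the matrix of the exterior derivative with respect to the family `b`:
`d b_j = ∑ i, G i j * b_i dx` as differentials of `ℚ_q(x, y)` over `ℚ_q`. -/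
def IsConnectionMatrix (F : (Zq p k)[X][X]) (b : Fin F.natDegree → FunField F)
    (G : Matrix (Fin F.natDegree) (Fin F.natDegree) (RatFunc (Qq p k))) : Prop :=
  ∀ j, KaehlerDifferential.D (Qq p k) (FunField F) (b j) =
    ∑ i, (G i j • b i) • KaehlerDifferential.D (Qq p k) (FunField F)
      (algebraMap (RatFunc (Qq p k)) (FunField F) RatFunc.X)

end Connection

/-! ### Exponents -/

section Exponents

variable {d : ℕ}

/-- The inclusion of `K(x)` into `Ω(x)` for a field extension `Ω` of `K`. -/
def ratFuncBaseChange (K Ω : Type*) [Field K] [Field Ω] [Algebra K Ω] :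
    RatFunc K →+* RatFunc Ω :=
  RatFunc.mapRingHom (Polynomial.mapRingHom (algebraMap K Ω))
    (nonZeroDivisors_le_comap_nonZeroDivisors_of_injective _
      (Polynomial.map_injective _ (algebraMap K Ω).injective))

variable {Ω : Type*} [Field Ω]

/-- `G dx` has at most a simple pole at `x₀`: the entries of `(x - x₀) G` have no pole at `x₀`. -/
def HasAtMostSimplePole (G : Matrix (Fin d) (Fin d) (RatFunc Ω)) (x₀ : Ω) : Prop :=
  ∀ i j, ((RatFunc.X - RatFunc.C x₀) * G i j).denom.eval x₀ ≠ 0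

/-- The residue matrix `(x - x₀) G |_{x = x₀}`. -/
def residueMatrix (G : Matrix (Fin d) (Fin d) (RatFunc Ω)) (x₀ : Ω) :
    Matrix (Fin d) (Fin d) Ω :=
  G.map fun g => ((RatFunc.X - RatFunc.C x₀) * g).eval (RingHom.id Ω) x₀

/-- The exponents of `G dx` at `x₀` (for `G dx` with at most a simple pole there): the eigenvalues
of its residue matrix. -/
def exponents (G : Matrix (Fin d) (Fin d) (RatFunc Ω)) (x₀ : Ω) : Set Ω :=
  {μ | Module.End.HasEigenvalue (Matrix.toLin' (residueMatrix G x₀)) μ}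

/-- The matrix `H` over `Ω(t)` with `H(t) dt = G(x) dx` after the substitution `x = 1/t`, namely
`H(t) = - t⁻² G(1/t)`. -/
def substInv (G : Matrix (Fin d) (Fin d) (RatFunc Ω)) : Matrix (Fin d) (Fin d) (RatFunc Ω) :=
  G.map fun g =>
    -((RatFunc.X : RatFunc Ω)⁻¹ ^ 2) * g.eval (RatFunc.C : Ω →+* RatFunc Ω) (RatFunc.X)⁻¹

end Exponents

/-- `μ` lies in `ℚ ∩ ℤ_p` and in the interval `[0, 1)`. -/
def IsPAdicallyIntegralRatInUnitInterval (p : ℕ) [Fact p.Prime] {Ω : Type*} [Field Ω]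
    (μ : Ω) : Prop :=
  ∃ c : ℚ, μ = (c : Ω) ∧ 0 ≤ c ∧ c < 1 ∧ ∃ z : ℤ_[p], (z : ℚ_[p]) = (c : ℚ_[p])

end GaussManin

end

/-!
Let `∂ = d/dx` on the function field `L = ℚ_q(x, y)`. Since `L` is formally étale over `ℚ_q[x]`,
its differentials are free on `dx`, so a connection matrix of a family `b` is the matrix of `∂` in
`b` (`exists_derivation`); it exists and is unique because both families are bases of `L` over
`ℚ_q(x)`. An eigenvalue of a residue matrix is then controlled in two independent steps.

*The exponents are rational numbers `a / e` with `0 ≤ a < e`.* At a finite point `x₀`, smoothness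
of the plane curve makes `(x - x₀) dy/dx = w / s` regular above `x₀` (`exists_clear_pole`), and
`w` vanishes at each point `(x₀, y₁)`, with leading coefficient `s(x₀) / e` at a point of
ramification index `e ≥ 2` (`exists_factor_of_ramified`). Hence, with `K` the algebraic closure
and `P = F(x₀, y)`, the residue acts on `K[y] / P` by `f ↦ f' w / s(x₀)`. An eigenvector `f` has
degree less than `P`, so it vanishes at some root `y₁` of `P` to an order `a` smaller than the
multiplicity `e` of the root, and comparing lowest terms gives the eigenvalue `a / e`
(`finite_exponents`).

At infinity put `t = 1/x` and `δ = t d/dt = -x ∂`. At a place over `t = 0` of ramification index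
`e`, an element `f` of order `κ` satisfies `δ f ≡ (κ / e) f` up to terms that improve on any given
bound for the pole of `δ`, because `f ^ e / t ^ κ` is a unit, and the residue field is algebraic
over the constants (`LocalData.val_deriv_sub_le`). So `δ` has no pole (`LocalData.val_deriv_le`),
and `∏ (δ - a / e)` over `0 ≤ a < e` maps integral elements to multiples of `t` locally. Taking
the product over all places, and coordinates in an integral basis, gives a polynomial with roots
`a / e` that annihilates the residue matrix (`exists_matrix_of_integralBasis`).

*The exponents are integral over `ℤ_q`.* The discriminant `Δ` clears the denominators of the
connection matrix of the powers of `y`, and `Δ` times a power of `x` those of the matrix at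
infinity. The étale divisor on the projective line makes `r` coprime to its derivative over `ℤ_q`,
with a unit as leading coefficient (`ClosedInP1.isCoprime_derivative`,
`ClosedInP1.isUnit_leadingCoeff`), and `Δ` divides a power of `r`, since it does not vanish modulo
`p`. At a root `x₀` of `r`, therefore, `x₀` and `1 / r'(x₀)` are integral, and a residue is a
Taylor coefficient of a polynomial over `ℤ_q` divided by an integral unit
(`isIntegral_eval_of_mul_eq`); the same holds at infinity. Residue matrices are thus integral,
hence so are their eigenvalues, and a rational number integral over `ℤ_q` lies in `ℤ_p`.
-/

noncomputable section

namespace GaussManin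

/-! ### The partial derivative with respect to the inner variable -/

/-- The partial derivative `∂F/∂x` of `F ∈ R[x][y]`; the partial derivative `∂F/∂y` is
`Polynomial.derivative F`. -/
def xDeriv (R : Type*) [CommRing R] : Derivation R R[X][X] R[X][X] :=
  Derivation.mk' ((Bivariate.swap (R := R)).toLinearMap ∘ₗ
      ((derivative (R := R[X])).restrictScalars R) ∘ₗ (Bivariate.swap (R := R)).toLinearMap) (by
    intro a b
    simp only [LinearMap.comp_apply, AlgEquiv.toLinearMap_apply, map_mul,
      LinearMap.coe_restrictScalars, derivative_mul, map_add, smul_eq_mul,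
      Bivariate.swap_swap_apply]
    ring)

lemma coeff_xDeriv {R : Type*} [CommRing R] (F : R[X][X]) (j : ℕ) :
    (xDeriv R F).coeff j = derivative (F.coeff j) := by
  induction F using Polynomial.induction_on' with
  | add f g hf hg => simp [hf, hg]
  | monomial n f =>
    induction f using Polynomial.induction_on' with
    | add f g hf hg => rw [map_add, map_add, coeff_add, hf, hg]; simp
    | monomial m a =>
      change (Bivariate.swap (derivative (Bivariate.swap (monomial n (monomial m a))))).coeff j = _
      rw [Bivariate.swap_monomial_monomial, derivative_monomial,
        show (monomial n a * (m : R[X])) = monomial n (a * m) by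
          rw [← C_eq_natCast, monomial_mul_C], Bivariate.swap_monomial_monomial]
      simp only [coeff_monomial]
      split_ifs <;> simp [derivative_monomial]

lemma xDeriv_map {R S : Type*} [CommRing R] [CommRing S] (φ : R →+* S) (F : R[X][X]) :
    xDeriv S (F.map (mapRingHom φ)) = (xDeriv R F).map (mapRingHom φ) := by
  ext1 j
  simp [coeff_xDeriv, derivative_map]

@[simp] lemma xDeriv_C {R : Type*} [CommRing R] (a : R[X]) :
    xDeriv R (C a) = C (derivative a) := by
  ext1 j
  simp only [coeff_xDeriv, coeff_C]
  split_ifs <;> simp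

@[simp] lemma xDeriv_map_C {R : Type*} [CommRing R] (P : R[X]) : xDeriv R (P.map C) = 0 := by
  ext1 j
  simp [coeff_xDeriv]

/-! ### Connection matrices of a power basis -/

/-- The polynomial `∑ i, G i j * y ^ i` given by the `j`-th column of `G`. -/
def colPoly {E : Type*} [CommRing E] {d : ℕ} (G : Matrix (Fin d) (Fin d) E) (j : Fin d) : E[X] :=
  ∑ i, C (G i j) * X ^ (i : ℕ)

lemma degree_colPoly_lt {E : Type*} [CommRing E] {d : ℕ}
    (G : Matrix (Fin d) (Fin d) E) (j : Fin d) : (colPoly G j).degree < d :=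
  (degree_sum_fin_lt fun i => G i j)

lemma coeff_colPoly {E : Type*} [CommRing E] {d : ℕ}
    (G : Matrix (Fin d) (Fin d) E) (i j : Fin d) : (colPoly G j).coeff i = G i j := by
  simp only [colPoly, finsetSum_coeff, coeff_C_mul, coeff_X_pow]
  rw [Finset.sum_eq_single i] <;> simp +contextual [Fin.ext_iff, eq_comm]

/-- The congruence `F_y · ∑ i, G i j * y ^ i ≡ - j * y ^ (j - 1) * F_x` modulo `F`, which
characterizes the matrix of `d/dx` on the powers of a root `y` of `F`, since
`F_y dy + F_x dx = 0`. -/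
def PowerRel {R E : Type*} [CommRing R] [CommRing E] (φ : R[X] →+* E) (F : R[X][X]) {d : ℕ}
    (G : Matrix (Fin d) (Fin d) E) : Prop :=
  ∀ j, F.map φ ∣ (derivative F).map φ * colPoly G j +
    (((j : ℕ) : E[X]) * X ^ ((j : ℕ) - 1)) * (xDeriv R F).map φ

lemma PowerRel.map {R E R' E' : Type*} [CommRing R] [CommRing E] [CommRing R'] [CommRing E']
    {φ : R[X] →+* E} {φ' : R'[X] →+* E'} (f : R →+* R') (g : E →+* E')
    (h : g.comp φ = φ'.comp (mapRingHom f)) {F : R[X][X]} {d : ℕ}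
    {G : Matrix (Fin d) (Fin d) E} (hG : PowerRel φ F G) :
    PowerRel φ' (F.map (mapRingHom f)) (G.map g) := by
  intro j
  have := Polynomial.map_dvd g (hG j)
  simpa [Polynomial.map_map, h, ← derivative_map, xDeriv_map, colPoly, Polynomial.map_sum]
    using this

/-- A relation `σ F_x + F_y w ≡ 0` modulo `F` says that `σ dy/dx = w`; hence it clears the
denominators of the connection matrix. -/
lemma PowerRel.mul_apply {R E : Type*} [CommRing R] [Field E] {φ : R[X] →+* E}
    {F : R[X][X]} (hF : F.Monic) {d : ℕ} (hd : F.natDegree = d)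
    (hcop : IsCoprime (F.map φ) ((derivative F).map φ))
    {G : Matrix (Fin d) (Fin d) E} (hG : PowerRel φ F G) {σ : R[X]} {w z : R[X][X]}
    (h : C σ * xDeriv R F + derivative F * w = F * z) (i j : Fin d) :
    φ σ * G i j = φ (((((j : ℕ) : R[X][X]) * X ^ ((j : ℕ) - 1) * w) %ₘ F).coeff i) := by
  set v : R[X][X] := ((j : ℕ) : R[X][X]) * X ^ ((j : ℕ) - 1) * w with hv
  have h' := congrArg (Polynomial.map φ) h
  simp only [Polynomial.map_add, Polynomial.map_mul, map_C] at h'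
  have hFm : (F.map φ).Monic := hF.map φ
  have hdvd : F.map φ ∣ C (φ σ) * colPoly G j - v.map φ := by
    refine hcop.dvd_of_dvd_mul_left ?_
    have e : (derivative F).map φ * (C (φ σ) * colPoly G j - v.map φ) =
        C (φ σ) * ((derivative F).map φ * colPoly G j +
          (((j : ℕ) : E[X]) * X ^ ((j : ℕ) - 1)) * (xDeriv R F).map φ) -
        F.map φ * (z.map φ * (((j : ℕ) : E[X]) * X ^ ((j : ℕ) - 1))) := by
      rw [← mul_assoc (F.map φ), ← h', hv]
      simp only [Polynomial.map_mul, Polynomial.map_natCast, Polynomial.map_pow, map_X]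
      ring
    rw [e]
    exact dvd_sub ((hG j).mul_left _) (dvd_mul_right _ _)
  have hdvd2 : F.map φ ∣ C (φ σ) * colPoly G j - (v %ₘ F).map φ := by
    have : C (φ σ) * colPoly G j - (v %ₘ F).map φ =
        (C (φ σ) * colPoly G j - v.map φ) + F.map φ * (v /ₘ F).map φ := by
      conv_lhs => rw [modByMonic_eq_sub_mul_div v F]
      simp only [Polynomial.map_sub, Polynomial.map_mul]
      ring
    rw [this]
    exact dvd_add hdvd (dvd_mul_right _ _)
  have hdegF : (F.map φ).degree = d := by
    rw [hF.degree_map, degree_eq_natDegree, hd]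
    rintro rfl
    have := hFm.ne_zero
    simp at this
  have h0 : C (φ σ) * colPoly G j - (v %ₘ F).map φ = 0 := by
    refine eq_zero_of_dvd_of_degree_lt hdvd2 ?_
    rw [hdegF]
    refine (degree_sub_le _ _).trans_lt (max_lt ?_ ?_)
    · refine lt_of_le_of_lt ?_ (degree_colPoly_lt G j)
      rw [← smul_eq_C_mul]; exact degree_smul_le _ _
    · rw [map_modByMonic _ hF, ← hdegF]
      exact degree_modByMonic_lt _ hFm
  have := congrArg (fun q => q.coeff (i : ℕ)) h0
  simpa [coeff_colPoly, sub_eq_zero] using this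

/-! ### Smooth plane curves: a bound for the pole of `dy/dx` -/

section Local

variable {K : Type*} [Field K]

lemma exists_eq_add_C_mul (F : K[X][X]) (x₀ : K) :
    ∃ H : K[X][X], F = (F.map (evalRingHom x₀)).map C + C (X - C x₀) * H := by
  have : C (X - C x₀) ∣ F - (F.map (evalRingHom x₀)).map C := by
    rw [C_dvd_iff_dvd_coeff]
    intro i
    rw [dvd_iff_isRoot]
    simp
  obtain ⟨H, hH⟩ := this
  exact ⟨H, by rw [← hH]; ring⟩

lemma eval_map_evalRingHom (F : K[X][X]) (x₀ y₁ : K) :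
    (F.map (evalRingHom x₀)).eval y₁ = F.evalEval x₀ y₁ :=
  map_evalRingHom_eval x₀ y₁ F

/-- The ideal of those `a` for which `a · (x - x₀) · F_x` is a multiple of `F_y` modulo `F`, that
is, `a · (x - x₀) · dy/dx` is regular on the curve `F = 0`. -/
def poleIdeal (F : K[X][X]) (x₀ : K) : Ideal K[X][X] :=
  (Ideal.span {F, derivative F}).colon {C (X - C x₀) * xDeriv K F}

lemma mem_poleIdeal {F : K[X][X]} {x₀ : K} {a : K[X][X]} :
    a ∈ poleIdeal F x₀ ↔
      ∃ b c, b * F + c * derivative F = a * (C (X - C x₀) * xDeriv K F) := by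
  rw [poleIdeal, Submodule.mem_colon_singleton, smul_eq_mul, Ideal.mem_span_pair]

/-- Near a singular point of the fibre `x = x₀`, smoothness means that `x - x₀` is, up to a unit,
the power `(y - y₁) ^ e`; multiplying `F_y` by `y - y₁` then makes it divisible by `x - x₀`. -/
lemma exists_mem_poleIdeal_evalEval_ne_zero [CharZero K] {F : K[X][X]} (hF : F.Monic) {x₀ y₁ : K}
    (h0 : F.evalEval x₀ y₁ = 0)
    (hs : (derivative F).evalEval x₀ y₁ ≠ 0 ∨ (xDeriv K F).evalEval x₀ y₁ ≠ 0) :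
    ∃ a ∈ poleIdeal F x₀, a.evalEval x₀ y₁ ≠ 0 := by
  by_cases hy : (derivative F).evalEval x₀ y₁ = 0
  swap
  · refine ⟨derivative F, mem_poleIdeal.2 ⟨0, C (X - C x₀) * xDeriv K F, by ring⟩, hy⟩
  have hx := hs.resolve_left (not_not.2 hy)
  set P := F.map (evalRingHom x₀) with hP
  have hPm : P.Monic := hF.map _
  obtain ⟨H, hH⟩ := exists_eq_add_C_mul F x₀
  rw [← hP] at hH
  obtain ⟨P₁, hP₁, hnd⟩ := exists_eq_pow_rootMultiplicity_mul_and_not_dvd P hPm.ne_zero y₁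
  have hroot : P.IsRoot y₁ := by rw [IsRoot, hP, eval_map_evalRingHom, h0]
  have he : 0 < P.rootMultiplicity y₁ := (rootMultiplicity_pos hPm.ne_zero).2 hroot
  obtain ⟨e, hee⟩ : ∃ e, P.rootMultiplicity y₁ = e + 1 := ⟨_, (Nat.succ_pred_eq_of_pos he).symm⟩
  rw [hee] at hP₁
  rw [dvd_iff_isRoot, IsRoot] at hnd
  have hFx : (xDeriv K F).evalEval x₀ y₁ = H.evalEval x₀ y₁ := by
    conv_lhs => rw [hH]
    simp [Derivation.leibniz, evalEval_C]
  set V : K[X] := ((e + 1 : ℕ) : K[X]) * P₁ + (X - C y₁) * derivative P₁ with hV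
  have hV' : (X - C y₁) * derivative P = V * (X - C y₁) ^ (e + 1) := by
    rw [hP₁, hV]
    simp only [derivative_mul, derivative_X_sub_C_pow]
    simp
    ring
  refine ⟨-(H * V.map C) + (X - C (C y₁)) * P₁.map C * derivative H, mem_poleIdeal.2
    ⟨-(V.map C * xDeriv K F), P₁.map C * (X - C (C y₁)) * xDeriv K F, ?_⟩, ?_⟩
  · have h1 : derivative F = (derivative P).map C + C (X - C x₀) * derivative H := by
      conv_lhs => rw [hH]
      simp [derivative_map]
    have h2 : (X - C (C y₁)) * (derivative P).map C =
        V.map C * (X - C (C y₁)) ^ (e + 1) := by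
      have := congrArg (Polynomial.map (C : K →+* K[X])) hV'
      simpa using this
    have h3 : F = (X - C (C y₁)) ^ (e + 1) * P₁.map C + C (X - C x₀) * H := by
      conv_lhs => rw [hH, hP₁]
      simp
    rw [h1]
    generalize xDeriv K F = Fx at *
    rw [h3]
    linear_combination (P₁.map C * Fx) * h2
  · have : (P₁.map (C : K →+* K[X])).evalEval x₀ y₁ = P₁.eval y₁ := by simp [evalEval]
    simp only [evalEval_add, evalEval_neg, evalEval_mul, evalEval_sub, evalEval_X, evalEval_CC]
    have hVe : (V.map (C : K →+* K[X])).evalEval x₀ y₁ = (e + 1 : ℕ) * P₁.eval y₁ := by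
      have : (V.map (C : K →+* K[X])).evalEval x₀ y₁ = V.eval y₁ := by simp [evalEval]
      rw [this, hV]; simp
    rw [hVe, sub_self, zero_mul, zero_mul, add_zero, neg_ne_zero]
    exact mul_ne_zero (hFx ▸ hx) (mul_ne_zero (Nat.cast_ne_zero.2 e.succ_ne_zero) hnd)

/-- On a smooth plane curve `F = 0` the function `(x - x₀) · dy/dx` is regular above `x₀`. -/
lemma exists_clear_pole [CharZero K] [IsAlgClosed K] {F : K[X][X]} (hF : F.Monic) (x₀ : K)
    (hs : ∀ y₁, F.evalEval x₀ y₁ = 0 →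
      (derivative F).evalEval x₀ y₁ ≠ 0 ∨ (xDeriv K F).evalEval x₀ y₁ ≠ 0) :
    ∃ s : K[X], s.eval x₀ ≠ 0 ∧ ∃ w z : K[X][X],
      C (s * (X - C x₀)) * xDeriv K F + derivative F * w = F * z := by
  set J := poleIdeal F x₀ with hJ
  have hFJ : F ∈ J := mem_poleIdeal.2 ⟨C (X - C x₀) * xDeriv K F, 0, by ring⟩
  have hsurj : Function.Surjective (mapRingHom (evalRingHom x₀)) :=
    map_surjective _ fun a => ⟨C a, by simp⟩
  set J₀ : Ideal K[X] := J.map (mapRingHom (evalRingHom x₀)) with hJ₀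
  have htop : J₀ = ⊤ := by
    obtain ⟨g, hg⟩ := (IsPrincipalIdealRing.principal J₀).principal
    have hg' : J₀ = Ideal.span {g} := hg
    rw [hg', Ideal.span_singleton_eq_top]
    by_contra hnu
    have hFg : g ∣ F.map (evalRingHom x₀) := by
      rw [← Ideal.mem_span_singleton, ← hg']
      exact Ideal.mem_map_of_mem _ hFJ
    have hg0 : g ≠ 0 := by
      rintro rfl
      exact (hF.map (evalRingHom x₀)).ne_zero (zero_dvd_iff.1 hFg)
    obtain ⟨y₁, hy₁⟩ := IsAlgClosed.exists_root g fun h =>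
      hnu (isUnit_iff_degree_eq_zero.2 h)
    have hFy : F.evalEval x₀ y₁ = 0 := by
      rw [← eval_map_evalRingHom]
      exact eval_eq_zero_of_dvd_of_eval_eq_zero hFg hy₁
    obtain ⟨a, ha, hay⟩ := exists_mem_poleIdeal_evalEval_ne_zero hF hFy (hs y₁ hFy)
    refine hay ?_
    rw [← eval_map_evalRingHom]
    refine eval_eq_zero_of_dvd_of_eval_eq_zero ?_ hy₁
    rw [← Ideal.mem_span_singleton, ← hg']
    exact Ideal.mem_map_of_mem _ ha
  obtain ⟨a, haJ, ha⟩ := (Ideal.mem_map_iff_of_surjective _ hsurj).1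
    (show (1 : K[X]) ∈ J₀ by rw [htop]; trivial)
  obtain ⟨b, hb⟩ := exists_eq_add_C_mul a x₀
  rw [coe_mapRingHom] at ha
  rw [ha, Polynomial.map_one] at hb
  have hfin : Module.Finite K[X] (K[X][X] ⧸ J) := by
    have : Module.Finite K[X] (K[X][X] ⧸ Ideal.span {F}) := hF.finite_quotient
    refine Module.Finite.of_surjective
      (Ideal.Quotient.factorₐ K[X] ((Ideal.span_singleton_le_iff_mem J).2 hFJ)).toLinearMap ?_
    exact Ideal.Quotient.factor_surjective ((Ideal.span_singleton_le_iff_mem J).2 hFJ)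
  -- Nakayama's lemma turns `J + (x - x₀) = 1` into an element of `J` that depends on `x` only.
  obtain ⟨s, hs1, hs2⟩ := Submodule.exists_sub_one_mem_and_smul_eq_zero_of_fg_of_le_smul
    (Ideal.span {X - C x₀}) (⊤ : Submodule K[X] (K[X][X] ⧸ J)) hfin.fg_top (by
      rintro m -
      obtain ⟨q, rfl⟩ := Ideal.Quotient.mk_surjective m
      have : Ideal.Quotient.mk J q = (X - C x₀) • Ideal.Quotient.mk J (-(b * q)) := by
        rw [← Ideal.Quotient.mkₐ_eq_mk K[X], ← map_smul, Ideal.Quotient.mkₐ_eq_mk,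
          Ideal.Quotient.mk_eq_mk_iff_sub_mem, smul_eq_C_mul]
        convert J.mul_mem_left q haJ using 1
        rw [hb]; ring
      rw [this]
      exact Submodule.smul_mem_smul (Ideal.mem_span_singleton_self _) trivial)
  refine ⟨s, ?_, ?_⟩
  · obtain ⟨q, hq⟩ := Ideal.mem_span_singleton.1 hs1
    have := congrArg (Polynomial.eval x₀) hq
    simp only [eval_sub, eval_one, eval_mul, eval_X, eval_C, sub_self, zero_mul, sub_eq_zero]
      at this
    rw [this]; exact one_ne_zero
  · have h1 := hs2 (Ideal.Quotient.mk J 1) trivial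
    rw [← Ideal.Quotient.mkₐ_eq_mk K[X], ← map_smul, Ideal.Quotient.mkₐ_eq_mk,
      Ideal.Quotient.eq_zero_iff_mem, smul_eq_C_mul, mul_one] at h1
    obtain ⟨b', c', h⟩ := mem_poleIdeal.1 h1
    exact ⟨-c', b', by rw [C_mul]; linear_combination -h⟩

end Local

/-! ### Residues and exponents at finite points -/

section FiniteExponents

variable {K : Type*} [Field K]

lemma num_mul_eq_of_mul_eq {h : RatFunc K} {s N : K[X]}
    (hN : h * algebraMap K[X] (RatFunc K) s = algebraMap K[X] (RatFunc K) N) :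
    h.num * s = N * h.denom := by
  have hd : algebraMap K[X] (RatFunc K) h.denom ≠ 0 := by simpa using h.denom_ne_zero
  apply RatFunc.algebraMap_injective
  rw [map_mul, map_mul, ← hN]
  nth_rewrite 2 [← RatFunc.num_div_denom h]
  field_simp

lemma regular_of_mul_eq {h : RatFunc K} {s N : K[X]} {x₀ : K}
    (hN : h * algebraMap K[X] (RatFunc K) s = algebraMap K[X] (RatFunc K) N)
    (hs : s.eval x₀ ≠ 0) :
    h.denom.eval x₀ ≠ 0 ∧ h.eval (RingHom.id K) x₀ = N.eval x₀ / s.eval x₀ := by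
  have hs0 : s ≠ 0 := by rintro rfl; simp at hs
  have hs' : algebraMap K[X] (RatFunc K) s ≠ 0 := by simpa using hs0
  have hden : h.denom ∣ s := (RatFunc.denom_dvd hs0).2 ⟨N, by rw [← hN]; field_simp⟩
  have hd : h.denom.eval x₀ ≠ 0 := fun h0 =>
    hs (eval_eq_zero_of_dvd_of_eval_eq_zero hden h0)
  refine ⟨hd, ?_⟩
  have := congrArg (Polynomial.eval x₀) (num_mul_eq_of_mul_eq hN)
  rw [eval_mul, eval_mul] at this
  rw [RatFunc.eval, eval₂_id, eval₂_id, div_eq_div_iff hd hs, this]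

variable [CharZero K]

/-- The eigenvalue equation `f' w = s μ f` modulo `P`, read off at a root `y₁` of `P` of higher
multiplicity than its multiplicity as a root of `f`. -/
lemma eigenvalue_of_dvd {P f w u : K[X]} {s μ y₁ : K} (hP : P ≠ 0) (hf : f ≠ 0)
    (hlt : f.rootMultiplicity y₁ < P.rootMultiplicity y₁)
    (hw : w = (X - C y₁) * u) (hdvd : P ∣ derivative f * w - C (s * μ) * f) :
    s * μ = (f.rootMultiplicity y₁ : K) * u.eval y₁ := by
  obtain ⟨g, hg, hnd⟩ := exists_eq_pow_rootMultiplicity_mul_and_not_dvd f hf y₁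
  rw [dvd_iff_isRoot, IsRoot] at hnd
  set k := f.rootMultiplicity y₁ with hk
  have h1 : (X - C y₁) ^ (k + 1) ∣ derivative f * w - C (s * μ) * f :=
    ((le_rootMultiplicity_iff hP).1 hlt).trans hdvd
  have h2 : derivative f * w - C (s * μ) * f = (X - C y₁) ^ k *
      ((k : K[X]) * g * u + (X - C y₁) * derivative g * u - C (s * μ) * g) := by
    have h3 : derivative f * (X - C y₁) =
        (X - C y₁) ^ k * ((k : K[X]) * g + (X - C y₁) * derivative g) := by
      rw [hg, derivative_mul, derivative_X_sub_C_pow]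
      rcases Nat.eq_zero_or_pos k with h0 | h0
      · rw [h0]; simp; ring
      · obtain ⟨n, hn⟩ := Nat.exists_eq_add_one.2 h0
        rw [hn, Nat.add_sub_cancel, C_eq_natCast]; ring
    rw [hw, ← mul_assoc, h3]
    linear_combination (-C (s * μ)) * hg
  rw [h2, pow_succ] at h1
  have h4 := (mul_dvd_mul_iff_left (pow_ne_zero k (X_sub_C_ne_zero y₁))).1 h1
  rw [dvd_iff_isRoot, IsRoot] at h4
  simp only [eval_sub, eval_add, eval_mul, eval_natCast, eval_X, eval_C, sub_self, zero_mul,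
    add_zero] at h4
  have h5 : (s * μ - k * u.eval y₁) * g.eval y₁ = 0 := by linear_combination -h4
  exact sub_eq_zero.1 ((mul_eq_zero.1 h5).resolve_right hnd)

/-- If `dy/dx` is `w / (s · (x - x₀))` on a smooth plane curve, then above `x₀` the function `w`
vanishes at each point, and its leading coefficient at a point of ramification index `e ≥ 2` is
`s / e`. -/
lemma exists_factor_of_ramified {F w z : K[X][X]} (hF : F.Monic) {x₀ y₁ : K} {s : K[X]}
    (h0 : F.evalEval x₀ y₁ = 0)
    (hs : (derivative F).evalEval x₀ y₁ ≠ 0 ∨ (xDeriv K F).evalEval x₀ y₁ ≠ 0)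
    (h : C (s * (X - C x₀)) * xDeriv K F + derivative F * w = F * z) :
    ∃ u, w.map (evalRingHom x₀) = (X - C y₁) * u ∧
      (2 ≤ (F.map (evalRingHom x₀)).rootMultiplicity y₁ →
        ((F.map (evalRingHom x₀)).rootMultiplicity y₁ : K) * u.eval y₁ = s.eval x₀) := by
  set P := F.map (evalRingHom x₀) with hP
  have hPm : P.Monic := hF.map _
  have hroot : P.IsRoot y₁ := by rw [IsRoot, hP, eval_map_evalRingHom, h0]
  obtain ⟨P₁, hP₁, hnd⟩ := exists_eq_pow_rootMultiplicity_mul_and_not_dvd P hPm.ne_zero y₁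
  have he : 0 < P.rootMultiplicity y₁ := (rootMultiplicity_pos hPm.ne_zero).2 hroot
  obtain ⟨e, hee⟩ : ∃ e, P.rootMultiplicity y₁ = e + 1 := ⟨_, (Nat.succ_pred_eq_of_pos he).symm⟩
  rw [hee] at hP₁ ⊢
  rw [dvd_iff_isRoot, IsRoot] at hnd
  set w₀ := w.map (evalRingHom x₀) with hw₀
  set z₀ := z.map (evalRingHom x₀) with hz₀
  have h1 : derivative P * w₀ = P * z₀ := by
    have := congrArg (Polynomial.map (evalRingHom x₀)) h
    simpa [← derivative_map] using this
  set V : K[X] := ((e + 1 : ℕ) : K[X]) * P₁ + (X - C y₁) * derivative P₁ with hV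
  have h2 : V * w₀ = (X - C y₁) * (P₁ * z₀) := by
    have hne := pow_ne_zero e (X_sub_C_ne_zero y₁)
    apply mul_left_cancel₀ hne
    have h3 : derivative P = (X - C y₁) ^ e * V := by
      rw [hP₁, hV]
      simp only [derivative_mul, derivative_X_sub_C_pow]
      simp
      ring
    rw [← mul_assoc, ← h3, h1, hP₁]
    ring
  have hVe : V.eval y₁ = ((e + 1 : ℕ) : K) * P₁.eval y₁ := by simp [hV]
  have hVne : V.eval y₁ ≠ 0 := by
    rw [hVe]; exact mul_ne_zero (Nat.cast_ne_zero.2 e.succ_ne_zero) hnd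
  have hw0 : w₀.eval y₁ = 0 := by
    have := congrArg (Polynomial.eval y₁) h2
    simp only [eval_mul, eval_sub, eval_X, eval_C, sub_self, zero_mul] at this
    exact (mul_eq_zero.1 this).resolve_left hVne
  obtain ⟨u, hu⟩ := dvd_iff_isRoot.2 hw0
  refine ⟨u, hu, fun he2 => ?_⟩
  have h5 : V * u = P₁ * z₀ := by
    apply mul_left_cancel₀ (X_sub_C_ne_zero y₁)
    rw [← h2, hu]; ring
  have h6 : ((e + 1 : ℕ) : K) * u.eval y₁ = z₀.eval y₁ := by
    have := congrArg (Polynomial.eval y₁) h5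
    rw [eval_mul, eval_mul, hVe] at this
    apply mul_left_cancel₀ hnd
    linear_combination this
  rw [h6]
  have hFy : (derivative F).evalEval x₀ y₁ = 0 := by
    rw [← eval_map_evalRingHom, ← derivative_map, ← hP, hP₁]
    obtain ⟨n, rfl⟩ : ∃ n, e = n + 1 := ⟨e - 1, by omega⟩
    simp [derivative_X_sub_C_pow]
  have hFx := hs.resolve_left (not_not.2 hFy)
  have hw1 : w.evalEval x₀ y₁ = 0 := by rw [← eval_map_evalRingHom, ← hw₀, hw0]
  -- Differentiate the relation with respect to `x` and evaluate at `(x₀, y₁)`.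
  have h7 := congrArg (fun q => (xDeriv K q).evalEval x₀ y₁) h
  simp only [map_add, Derivation.leibniz, smul_eq_mul, evalEval_add, evalEval_mul, xDeriv_C,
    evalEval_C, h0, hFy, hw1, derivative_mul, derivative_X_sub_C, eval_mul, eval_sub,
    eval_X, eval_C, sub_self, zero_mul, mul_zero, mul_one, add_zero, zero_add] at h7
  rw [hz₀, eval_map_evalRingHom]
  apply mul_left_cancel₀ hFx
  rw [mul_comm _ (z.evalEval x₀ y₁), ← h7]

variable [IsAlgClosed K]

/-- For a smooth plane curve `F = 0`, monic in `y`, the connection matrix of the power basis has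
at most simple poles at finite points, and its exponents are of the form `k / e` with `k < e`. -/
theorem finite_exponents {F : K[X][X]} (hF : F.Monic) {d : ℕ} (hd : F.natDegree = d)
    {x₀ : K} (hs : ∀ y₁, F.evalEval x₀ y₁ = 0 →
      (derivative F).evalEval x₀ y₁ ≠ 0 ∨ (xDeriv K F).evalEval x₀ y₁ ≠ 0)
    (hcop : IsCoprime (F.map (algebraMap K[X] (RatFunc K)))
      ((derivative F).map (algebraMap K[X] (RatFunc K))))
    {G : Matrix (Fin d) (Fin d) (RatFunc K)} (hG : PowerRel (algebraMap K[X] (RatFunc K)) F G) :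
    HasAtMostSimplePole G x₀ ∧
      ∀ μ ∈ exponents G x₀, ∃ k e : ℕ, k < e ∧ μ = (k : K) / e := by
  obtain ⟨s, hs0, w, z, hwz⟩ := exists_clear_pole hF x₀ hs
  set v : Fin d → K[X][X] := fun j => ((j : ℕ) : K[X][X]) * X ^ ((j : ℕ) - 1) * w with hv
  have hmul : ∀ i j, ((RatFunc.X - RatFunc.C x₀) * G i j) * algebraMap K[X] (RatFunc K) s =
      algebraMap K[X] (RatFunc K) ((v j %ₘ F).coeff i) := by
    intro i j
    rw [← hG.mul_apply hF hd hcop hwz i j, map_mul, map_sub, RatFunc.algebraMap_X,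
      RatFunc.algebraMap_C]
    ring
  refine ⟨fun i j => (regular_of_mul_eq (hmul i j) hs0).1, ?_⟩
  intro μ hμ
  set P := F.map (evalRingHom x₀) with hP
  have hPm : P.Monic := hF.map _
  have hPd : P.degree = d := by rw [hF.degree_map, degree_eq_natDegree hF.ne_zero, hd]
  set w₀ := w.map (evalRingHom x₀) with hw₀
  have hres : ∀ i j, s.eval x₀ * residueMatrix G x₀ i j =
      (((((j : ℕ) : K[X]) * X ^ ((j : ℕ) - 1) * w₀) %ₘ P).coeff i) := by
    intro i j
    rw [residueMatrix, Matrix.map_apply, (regular_of_mul_eq (hmul i j) hs0).2,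
      mul_div_cancel₀ _ hs0, ← coe_evalRingHom, ← coeff_map, map_modByMonic _ hF]
    simp [hv, hw₀, hP]
  obtain ⟨c, hc, hc0⟩ := Module.End.HasEigenvalue.exists_hasEigenvector hμ
  rw [Module.End.mem_eigenspace_iff, Matrix.toLin'_apply] at hc
  set f : K[X] := ∑ j, C (c j) * X ^ (j : ℕ) with hf
  have hfdeg : f.degree < d := degree_sum_fin_lt c
  have hfc : ∀ i : Fin d, f.coeff i = c i := by
    intro i
    simp only [hf, finsetSum_coeff, coeff_C_mul, coeff_X_pow]
    rw [Finset.sum_eq_single i] <;> simp +contextual [Fin.ext_iff, eq_comm]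
  have hf0 : f ≠ 0 := by
    intro h
    apply hc0
    ext i
    rw [← hfc, h]; simp
  have hder : derivative f * w₀ =
      ∑ j, C (c j) * (((j : ℕ) : K[X]) * X ^ ((j : ℕ) - 1) * w₀) := by
    simp only [hf, derivative_sum, derivative_C_mul, derivative_X_pow, Finset.sum_mul,
      C_eq_natCast]
    exact Finset.sum_congr rfl fun j _ => by ring
  have hsum : ∑ j, C (c j) * ((((j : ℕ) : K[X]) * X ^ ((j : ℕ) - 1) * w₀) %ₘ P) =
      C (s.eval x₀ * μ) * f := by
    ext n
    by_cases hn : n < d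
    · have hcn := congrFun hc ⟨n, hn⟩
      have := hfc ⟨n, hn⟩
      simp only at this
      simp only [finsetSum_coeff, coeff_C_mul, this]
      have h1 := fun j => hres ⟨n, hn⟩ j
      simp only at h1
      simp_rw [← h1]
      rw [mul_assoc, show μ * c ⟨n, hn⟩ = (μ • c) ⟨n, hn⟩ from rfl, ← hcn, Matrix.mulVec,
        dotProduct, Finset.mul_sum]
      exact Finset.sum_congr rfl fun j _ => by ring
    · have hdn : (d : WithBot ℕ) ≤ n := by exact_mod_cast not_lt.1 hn
      simp only [finsetSum_coeff, coeff_C_mul]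
      rw [coeff_eq_zero_of_degree_lt (hfdeg.trans_le hdn), mul_zero]
      refine Finset.sum_eq_zero fun j _ => ?_
      rw [coeff_eq_zero_of_degree_lt, mul_zero]
      exact (degree_modByMonic_lt _ hPm).trans_le (hPd ▸ hdn)
  have hdvd : P ∣ derivative f * w₀ - C (s.eval x₀ * μ) * f := by
    rw [hder, ← hsum, ← Finset.sum_sub_distrib]
    refine Finset.dvd_sum fun j _ => ?_
    rw [← mul_sub, modByMonic_eq_sub_mul_div]
    exact Dvd.dvd.mul_left (by simp) _
  obtain ⟨y₁, hy₁⟩ : ∃ y₁, f.rootMultiplicity y₁ < P.rootMultiplicity y₁ := by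
    classical
    by_contra! hcon
    have : P ∣ f := by
      rw [(IsAlgClosed.splits P).dvd_iff_roots_le_roots hPm.ne_zero hf0, Multiset.le_iff_count]
      simpa using hcon
    exact hf0 (eq_zero_of_dvd_of_degree_lt this (hPd ▸ hfdeg))
  have hFy₁ : F.evalEval x₀ y₁ = 0 := by
    rw [← eval_map_evalRingHom]
    exact (rootMultiplicity_pos hPm.ne_zero).1 (Nat.zero_le _ |>.trans_lt hy₁)
  obtain ⟨u, hu, hue⟩ := exists_factor_of_ramified hF hFy₁ (hs y₁ hFy₁) hwz
  have hμ' := eigenvalue_of_dvd hPm.ne_zero hf0 hy₁ hu hdvd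
  refine ⟨f.rootMultiplicity y₁, P.rootMultiplicity y₁, hy₁, ?_⟩
  have hene : ((P.rootMultiplicity y₁ : ℕ) : K) ≠ 0 := Nat.cast_ne_zero.2 (by omega)
  rw [eq_div_iff hene]
  apply mul_left_cancel₀ hs0
  rcases Nat.eq_zero_or_pos (f.rootMultiplicity y₁) with hk | hk
  · rw [hk, Nat.cast_zero, zero_mul] at hμ'
    rw [hk, ← mul_assoc, hμ']; simp
  · rw [← mul_assoc, hμ', mul_assoc, mul_comm (u.eval y₁), hue (lt_of_le_of_lt hk hy₁), mul_comm]

end FiniteExponents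

/-! ### Derivations and discrete valuations in residue characteristic zero -/

section LocalDerivation

open WithZero

variable {k₀ L : Type*} [Field k₀] [Field L] [Algebra k₀ L]

/-- The residue of the `v`-unit `b` is a simple root of a polynomial over the field of
constants. -/
def HasSeparableResidue (k₀ : Type*) {L : Type*} [Field k₀] [Field L] [Algebra k₀ L]
    (v : Valuation L ℤᵐ⁰) (b : L) : Prop :=
  v b = 1 ∧ ∃ f : k₀[X], v (aeval b f) < 1 ∧ v (aeval b (derivative f)) = 1

/-- The setting of a place of ramification index `e` over `t = 0`, with a derivation `δ` that
restricts to `t · d/dt`. The last condition says that the residue field is algebraic over the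
field of constants, tested on a numerator and a denominator of each unit. -/
structure LocalData (v : Valuation L ℤᵐ⁰) (δ : Derivation k₀ L L) (t : L) (e : ℕ) : Prop where
  const : ∀ c : k₀, c ≠ 0 → v (algebraMap k₀ L c) = 1
  deriv_t : δ t = t
  pos : 0 < e
  val_t : v t = exp (-(e : ℤ))
  units : ∀ u, v u = 1 → ∃ n d, u * d = n ∧ HasSeparableResidue k₀ v n ∧
    HasSeparableResidue k₀ v d

variable {v : Valuation L ℤᵐ⁰} {δ : Derivation k₀ L L} {t : L} {e : ℕ}

/-- Applying `δ` to `f(b)`, which has positive order, improves a bound on the pole of `δ` by one. -/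
lemma val_deriv_le_of_hasSeparableResidue {m : ℤ} (hm : ∀ a, v (δ a) ≤ v a * exp m) {b : L}
    (hb : HasSeparableResidue k₀ v b) : v (δ b) ≤ exp (m - 1) := by
  obtain ⟨-, f, hf, hf'⟩ := hb
  have h1 := hm (aeval b f)
  rw [Derivation.map_aeval, smul_eq_mul, map_mul, hf', one_mul] at h1
  refine h1.trans ?_
  rw [sub_eq_neg_add, exp_add]
  gcongr
  have : v (aeval b f) < exp (-1) * exp 1 := by rwa [← exp_add]
  exact (lt_mul_exp_iff_le (by simp)).1 this

lemma LocalData.val_deriv_unit_le (h : LocalData v δ t e) {m : ℤ}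
    (hm : ∀ a, v (δ a) ≤ v a * exp m) {u : L} (hu : v u = 1) : v (δ u) ≤ exp (m - 1) := by
  obtain ⟨n, d, hnd, hn, hd⟩ := h.units u hu
  have h1 : δ u * d = δ n - u * δ d := by
    rw [← hnd, Derivation.leibniz, smul_eq_mul, smul_eq_mul]; ring
  have h2 : v (δ u * d) ≤ exp (m - 1) := by
    rw [h1]
    refine v.map_sub_le (val_deriv_le_of_hasSeparableResidue hm hn) ?_
    rw [map_mul, hu, one_mul]
    exact val_deriv_le_of_hasSeparableResidue hm hd
  rwa [map_mul, hd.1, mul_one] at h2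

/-- If `v a = exp (-κ)` then `δ a - (κ / e) a` is smaller than `δ a` is allowed to be, because
`a ^ e / t ^ κ` is a unit with logarithmic derivative `e δ a / a - κ`. -/
lemma LocalData.val_deriv_sub_le [CharZero k₀] (h : LocalData v δ t e) {m : ℤ}
    (hm : ∀ a, v (δ a) ≤ v a * exp m) {a : L} {κ : ℤ} (ha : v a = exp (-κ)) :
    v (δ a - ((κ : k₀) / e) • a) ≤ v a * exp (m - 1) := by
  have ha0 : a ≠ 0 := by rintro rfl; rw [map_zero] at ha; exact exp_ne_zero ha.symm
  have ht0 : t ≠ 0 := by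
    rintro rfl
    have := h.val_t
    rw [map_zero] at this
    exact exp_ne_zero this.symm
  set w := a ^ e * t ^ (-κ) with hw
  have hw1 : v w = 1 := by
    rw [hw, map_mul, map_pow, map_zpow₀, ha, h.val_t, ← exp_nsmul, ← exp_zsmul, ← exp_add]
    simp only [smul_eq_mul, nsmul_eq_mul]
    rw [exp_eq_one]; ring
  have hδw : a * δ w = w * (e * δ a - κ * a) := by
    rw [hw, Derivation.leibniz, Derivation.leibniz_pow, Derivation.leibniz_zpow, h.deriv_t]
    obtain ⟨n, rfl⟩ := Nat.exists_eq_add_one.2 h.pos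
    have : t ^ (-κ - 1) * t = t ^ (-κ) := by rw [← zpow_add_one₀ ht0]; congr 1; ring
    simp only [smul_eq_mul, nsmul_eq_mul, zsmul_eq_mul, Nat.add_sub_cancel, this]
    push_cast
    ring
  have he0 : (e : k₀) ≠ 0 := Nat.cast_ne_zero.2 h.pos.ne'
  have h1 : δ a - ((κ : k₀) / e) • a = algebraMap k₀ L (e : k₀)⁻¹ * (e * δ a - κ * a) := by
    have : (e : L) ≠ 0 := by
      have := (map_ne_zero (algebraMap k₀ L)).2 he0
      simpa using this
    rw [Algebra.smul_def]
    simp only [map_div₀, map_inv₀, map_intCast, map_natCast]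
    field_simp
  rw [h1, map_mul, h.const _ (inv_ne_zero he0), one_mul]
  have h2 : v (e * δ a - κ * a) = v a * v (δ w) := by
    rw [← map_mul, hδw, map_mul, hw1, one_mul]
  rw [h2]
  gcongr
  exact h.val_deriv_unit_le hm hw1

lemma exists_val_eq_exp {a : L} (ha : a ≠ 0) : ∃ κ : ℤ, v a = exp (-κ) :=
  ⟨-log (v a), by rw [neg_neg, exp_log ((Valuation.ne_zero_iff v).2 ha)]⟩

lemma LocalData.val_smul_le (h : LocalData v δ t e) (c : k₀) (a : L) : v (c • a) ≤ v a := by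
  rcases eq_or_ne c 0 with rfl | hc
  · simp
  · rw [Algebra.smul_def, map_mul, h.const c hc, one_mul]

/-- A derivation `t · d/dt` with a bounded pole at `v` has no pole at all. -/
lemma LocalData.val_deriv_le [CharZero k₀] (h : LocalData v δ t e) (m : ℕ)
    (hm : ∀ a, v (δ a) ≤ v a * exp (m : ℤ)) (a : L) : v (δ a) ≤ v a := by
  induction m with
  | zero => simpa using hm a
  | succ m ih =>
    refine ih fun a => ?_
    rcases eq_or_ne a 0 with rfl | ha
    · simp
    obtain ⟨κ, hκ⟩ := exists_val_eq_exp (v := v) ha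
    have h1 := h.val_deriv_sub_le hm hκ
    have h2 : δ a = (δ a - ((κ : k₀) / e) • a) + ((κ : k₀) / e) • a := by ring
    rw [h2]
    refine v.map_add_le (by simpa using h1) ((h.val_smul_le _ _).trans ?_)
    conv_lhs => rw [← mul_one (v a)]
    gcongr
    rw [← exp_zero, exp_le_exp]
    positivity

/-- The polynomial with the simple roots `0, 1 / e, …, (e - 1) / e`. -/
def ramPoly (k₀ : Type*) [Field k₀] (e : ℕ) : k₀[X] :=
  ∏ i ∈ Finset.range e, (X - C ((i : k₀) / e))

lemma LocalData.val_aeval_le_one (h : LocalData v δ t e) (hδ : ∀ a, v (δ a) ≤ v a)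
    (q : k₀[X]) {a : L} (ha : v a ≤ 1) : v (aeval (δ : Module.End k₀ L) q a) ≤ 1 := by
  induction q using Polynomial.induction_on' with
  | add f g hf hg =>
    rw [map_add, LinearMap.add_apply]
    exact v.map_add_le hf hg
  | monomial n c =>
    rw [aeval_monomial, Module.End.mul_apply, Module.algebraMap_end_apply]
    refine (h.val_smul_le _ _).trans ?_
    induction n with
    | zero => simpa using ha
    | succ n ih =>
      rw [pow_succ', Module.End.mul_apply]
      exact (hδ _).trans ih

/-- On the `v`-integers modulo `t`, the derivation `t · d/dt` is killed by
`∏ k < e, (X - k / e)`. -/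
lemma LocalData.val_aeval_ramPoly_le [CharZero k₀] (h : LocalData v δ t e) (hδ : ∀ a, v (δ a) ≤ v a)
    {a : L} (ha : v a ≤ 1) : v (aeval (δ : Module.End k₀ L) (ramPoly k₀ e) a) ≤ v t := by
  have key : ∀ j : ℕ, v (aeval (δ : Module.End k₀ L)
      (∏ i ∈ Finset.range j, (X - C ((i : k₀) / e))) a) ≤ exp (-(j : ℤ)) := by
    intro j
    induction j with
    | zero => simpa using ha
    | succ j ih =>
      rw [Finset.prod_range_succ, mul_comm, map_mul, Module.End.mul_apply]
      set x := aeval (δ : Module.End k₀ L) (∏ i ∈ Finset.range j, (X - C ((i : k₀) / e))) a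
      have hx : aeval (δ : Module.End k₀ L) (X - C ((j : k₀) / e)) x =
          δ x - ((j : k₀) / e) • x := by
        simp [Module.algebraMap_end_apply]
      rw [hx]
      rcases eq_or_lt_of_le ih with h1 | h1
      · have := h.val_deriv_sub_le (m := 0) (fun a => by simpa using hδ a) h1
        rw [h1, ← exp_add] at this
        simpa [add_comm, sub_eq_add_neg] using this
      · have h2 : v x ≤ exp (-((j + 1 : ℕ) : ℤ)) := by
          have : v x < exp (-((j + 1 : ℕ) : ℤ)) * exp 1 := by
            rw [← exp_add]; simpa using h1
          exact (lt_mul_exp_iff_le (by simp)).1 this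
        exact v.map_sub_le ((hδ x).trans h2) ((h.val_smul_le _ _).trans h2)
  rw [h.val_t]
  exact key e

end LocalDerivation

/-! ### Integral bases and logarithmic derivations -/

section IntegralBasis

open WithZero IsDedekindDomain

variable {k₀ L : Type*} [Field k₀] [Field L] [Algebra k₀ L] {d : ℕ}

/-- An integral basis `b` of the function field `L` over the polynomial ring `k₀[t]`. The second
condition says that `L` is the field of fractions of the integral closure of `k₀[t]`. -/
structure IntegralBasisData (k₀ : Type*) {L : Type*} [Field k₀] [Field L] [Algebra k₀ L] {d : ℕ}
    (t : L) (b : Fin d → L) : Prop where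
  transcendental : Transcendental k₀ t
  frac : ∀ z : L, ∃ a : k₀[X], a ≠ 0 ∧ IsIntegral (Algebra.adjoin k₀ {t}) (aeval t a * z)
  indep : LinearIndependent (Algebra.adjoin k₀ {t}) b
  span : Submodule.span (Algebra.adjoin k₀ {t}) (Set.range b) =
    Subalgebra.toSubmodule (integralClosure (Algebra.adjoin k₀ {t}) L)

lemma exists_aeval_eq {t : L} (a : Algebra.adjoin k₀ {t}) : ∃ q : k₀[X], aeval t q = (a : L) := by
  have h : (a : L) ∈ (aeval t : k₀[X] →ₐ[k₀] L).range :=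
    Algebra.adjoin_singleton_eq_range_aeval k₀ t ▸ a.2
  exact h

lemma isIntegral_aeval (t : L) (q : k₀[X]) : IsIntegral (Algebra.adjoin k₀ {t}) (aeval t q) :=
  isIntegral_algebraMap
    (x := (⟨aeval t q, aeval_mem_adjoin_singleton k₀ t⟩ : Algebra.adjoin k₀ {t}))

variable {t : L} {b : Fin d → L}

namespace IntegralBasisData

lemma exists_coords (h : IntegralBasisData k₀ t b) {z : L}
    (hz : IsIntegral (Algebra.adjoin k₀ {t}) z) :
    ∃ n : Fin d → k₀[X], z = ∑ i, aeval t (n i) * b i := by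
  have h1 : z ∈ Submodule.span (Algebra.adjoin k₀ {t}) (Set.range b) := by
    rw [h.span]; exact hz
  obtain ⟨c, hc⟩ := (Submodule.mem_span_range_iff_exists_fun _).1 h1
  choose n hn using fun i => exists_aeval_eq (c i)
  refine ⟨n, ?_⟩
  rw [← hc]
  exact Finset.sum_congr rfl fun i _ => by rw [hn]; rfl

lemma isIntegral_basis (h : IntegralBasisData k₀ t b) (j : Fin d) :
    IsIntegral (Algebra.adjoin k₀ {t}) (b j) := by
  have h1 : b j ∈ Submodule.span (Algebra.adjoin k₀ {t}) (Set.range b) :=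
    Submodule.subset_span ⟨j, rfl⟩
  rw [h.span] at h1; exact h1

lemma coords_eq_zero (h : IntegralBasisData k₀ t b) {n : Fin d → k₀[X]}
    (hn : ∑ i, aeval t (n i) * b i = 0) (i : Fin d) : n i = 0 := by
  have := Fintype.linearIndependent_iff.1 h.indep
    (fun i => ⟨aeval t (n i), aeval_mem_adjoin_singleton k₀ t⟩)
    (by simpa [Algebra.smul_def] using hn) i
  exact (transcendental_iff.1 h.transcendental) _ (congrArg Subtype.val this)

lemma t_ne_zero (h : IntegralBasisData k₀ t b) : t ≠ 0 := by
  rintro rfl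
  exact h.transcendental isAlgebraic_zero

lemma isFractionRing (h : IntegralBasisData k₀ t b) :
    IsFractionRing (integralClosure (Algebra.adjoin k₀ {t}) L) L := by
  refine IsFractionRing.of_field _ _ fun z => ?_
  obtain ⟨a, ha, hz⟩ := h.frac z
  have ha' : aeval t a ≠ 0 := fun h0 => ha ((transcendental_iff.1 h.transcendental) _ h0)
  exact ⟨⟨_, hz⟩, ⟨_, isIntegral_aeval t a⟩, by
    change z = aeval t a * z / aeval t a
    field_simp⟩

lemma isDedekindDomain (h : IntegralBasisData k₀ t b) :
    IsDedekindDomain (integralClosure (Algebra.adjoin k₀ {t}) L) := by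
  set A := Algebra.adjoin k₀ {t} with hA
  have hsurj : Function.Surjective
      ((aeval t : k₀[X] →ₐ[k₀] L).codRestrict A
        (fun _ => aeval_mem_adjoin_singleton k₀ t)) := fun a => by
    obtain ⟨q, hq⟩ := exists_aeval_eq a
    exact ⟨q, Subtype.ext hq⟩
  have : IsPrincipalIdealRing A := IsPrincipalIdealRing.of_surjective _ hsurj
  have hfin : Module.Finite A (integralClosure A L) := by
    refine (Module.Finite.iff_fg (N := Subalgebra.toSubmodule (integralClosure A L))).2 ?_
    rw [← h.span]
    exact Submodule.fg_span (Set.finite_range b)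
  have : IsNoetherianRing (integralClosure A L) := IsNoetherianRing.of_finite A _
  have := h.isFractionRing
  have : IsIntegrallyClosed (integralClosure A L) :=
    (isIntegrallyClosed_iff_isIntegrallyClosedIn L).2 inferInstance
  exact { }

end IntegralBasisData

/-- `g` is regular at `t = 0`, and `c` are the values at `t = 0` of its coordinates with respect to
the family `b`. -/
def HasCoordsAtZero (t : L) (b : Fin d → L) (g : L) (c : Fin d → k₀) : Prop :=
  ∃ (s : k₀[X]) (n : Fin d → k₀[X]), s.eval 0 ≠ 0 ∧
    aeval t s * g = ∑ i, aeval t (n i) * b i ∧ ∀ i, (n i).eval 0 = s.eval 0 * c i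

namespace HasCoordsAtZero

variable {g g' : L} {c c' : Fin d → k₀}

lemma basis (j : Fin d) : HasCoordsAtZero t b (b j) (Pi.single j (1 : k₀)) := by
  refine ⟨1, Pi.single j 1, by simp, ?_, fun i => ?_⟩
  · rw [Finset.sum_eq_single j] <;> simp +contextual
  · by_cases h : i = j <;> simp [h]

lemma zero : HasCoordsAtZero t b 0 (0 : Fin d → k₀) := ⟨1, 0, by simp, by simp, by simp⟩

lemma add (h : HasCoordsAtZero t b g c) (h' : HasCoordsAtZero t b g' c') :
    HasCoordsAtZero t b (g + g') (c + c') := by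
  obtain ⟨s, n, hs, hg, hn⟩ := h
  obtain ⟨s', n', hs', hg', hn'⟩ := h'
  refine ⟨s * s', fun i => s' * n i + s * n' i, by simp [hs, hs'], ?_, fun i => ?_⟩
  · rw [map_mul, show aeval t s * aeval t s' * (g + g') =
      aeval t s' * (aeval t s * g) + aeval t s * (aeval t s' * g') by ring, hg, hg',
      Finset.mul_sum, Finset.mul_sum, ← Finset.sum_add_distrib]
    exact Finset.sum_congr rfl fun i _ => by simp only [map_add, map_mul]; ring
  · simp only [eval_add, eval_mul, hn, hn', Pi.add_apply]; ring

lemma sum {ι : Type*} (S : Finset ι) {g : ι → L} {c : ι → Fin d → k₀}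
    (h : ∀ i ∈ S, HasCoordsAtZero t b (g i) (c i)) :
    HasCoordsAtZero t b (∑ i ∈ S, g i) (∑ i ∈ S, c i) := by
  classical
  induction S using Finset.induction_on with
  | empty => simpa using zero
  | insert a S ha ih =>
    rw [Finset.sum_insert ha, Finset.sum_insert ha]
    exact (h a (by simp)).add (ih fun i hi => h i (by simp [hi]))

lemma aeval_mul (h : HasCoordsAtZero t b g c) (q : k₀[X]) :
    HasCoordsAtZero t b (aeval t q * g) (q.eval 0 • c) := by
  obtain ⟨s, n, hs, hg, hn⟩ := h
  refine ⟨s, fun i => q * n i, hs, ?_, fun i => ?_⟩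
  · rw [mul_left_comm, hg, Finset.mul_sum]
    exact Finset.sum_congr rfl fun i _ => by rw [map_mul]; ring
  · simp only [eval_mul, hn, Pi.smul_apply, smul_eq_mul]; ring

lemma of_aeval_mul {q : k₀[X]} (hq : q.eval 0 ≠ 0)
    (h : HasCoordsAtZero t b (aeval t q * g) (q.eval 0 • c)) : HasCoordsAtZero t b g c := by
  obtain ⟨s, n, hs, hg, hn⟩ := h
  refine ⟨s * q, n, by simp [hs, hq], ?_, fun i => ?_⟩
  · rw [← hg, map_mul, mul_assoc]
  · rw [hn, eval_mul, Pi.smul_apply, smul_eq_mul, mul_assoc]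

lemma unique (hb : IntegralBasisData k₀ t b) (h : HasCoordsAtZero t b g c)
    (h' : HasCoordsAtZero t b g c') : c = c' := by
  obtain ⟨s, n, hs, hg, hn⟩ := h
  obtain ⟨s', n', hs', hg', hn'⟩ := h'
  have key : ∑ i, aeval t (s' * n i - s * n' i) * b i = 0 := by
    have : aeval t s' * (aeval t s * g) - aeval t s * (aeval t s' * g) = 0 := by ring
    rw [hg, hg', Finset.mul_sum, Finset.mul_sum, ← Finset.sum_sub_distrib] at this
    rw [← this]
    exact Finset.sum_congr rfl fun i _ => by simp only [map_sub, map_mul]; ring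
  ext i
  have h1 := congrArg (Polynomial.eval 0) (hb.coords_eq_zero key i)
  simp only [eval_sub, eval_mul, hn, hn', eval_zero] at h1
  apply mul_left_cancel₀ (mul_ne_zero hs hs')
  linear_combination h1

end HasCoordsAtZero

lemma isIntegral_t : IsIntegral (Algebra.adjoin k₀ {t}) t := by
  simpa using isIntegral_aeval t (X : k₀[X])

lemma deriv_aeval {δ : Derivation k₀ L L} (hδ : δ t = t) (q : k₀[X]) :
    δ (aeval t q) = aeval t (derivative q * X) := by
  rw [Derivation.map_aeval, hδ, map_mul, aeval_X, smul_eq_mul]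

lemma exists_le_exp_natCast {ι : Type*} [Fintype ι] (y : ι → ℤᵐ⁰) :
    ∃ N : ℕ, ∀ i, y i ≤ exp (N : ℤ) := by
  refine ⟨∑ i, (log (y i)).toNat, fun i => le_exp_of_log_le ?_⟩
  refine (Int.self_le_toNat _).trans ?_
  exact_mod_cast Finset.single_le_sum (f := fun i => (log (y i)).toNat)
    (fun _ _ => Nat.zero_le _) (Finset.mem_univ i)

/-- The integral closure of `k₀[t]` in `L`. -/
abbrev intClosure (k₀ : Type*) {L : Type*} [Field k₀] [Field L] [Algebra k₀ L] (t : L) :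
    Subalgebra (Algebra.adjoin k₀ {t}) L :=
  integralClosure (Algebra.adjoin k₀ {t}) L

/-- The places of `L` over `t = 0`. -/
def IsPlaceOverZero (t : L)
    [IsDedekindDomain (intClosure k₀ t)]
    [IsFractionRing (intClosure k₀ t) L]
    (P : HeightOneSpectrum (intClosure k₀ t)) : Prop :=
  P.valuation L t < 1

section Places

variable [IsDedekindDomain (intClosure k₀ t)]
    [IsFractionRing (intClosure k₀ t) L]

lemma val_le_one_of_isIntegral (P : HeightOneSpectrum (intClosure k₀ t))
    {z : L} (hz : IsIntegral (Algebra.adjoin k₀ {t}) z) : P.valuation L z ≤ 1 :=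
  P.valuation_le_one (⟨z, hz⟩ : intClosure k₀ t)

lemma finite_isPlaceOverZero (ht : t ≠ 0) :
    {P : HeightOneSpectrum (intClosure k₀ t) |
      IsPlaceOverZero t P}.Finite := by
  set τ : intClosure k₀ t := ⟨t, isIntegral_t⟩ with hτ
  have h0 : Ideal.span {τ} ≠ 0 := by
    rw [Ne, Ideal.zero_eq_bot, Ideal.span_singleton_eq_bot]
    exact fun h => ht (congrArg Subtype.val h)
  refine (Ideal.finite_factors h0).subset fun P hP => ?_
  rw [Set.mem_ofPred_eq, Ideal.dvd_span_singleton]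
  exact (P.valuation_lt_one_iff_mem τ).1 hP

/-- An element without poles over `t = 0` becomes integral over `k₀[t]` after multiplication by a
polynomial in `t` that does not vanish at `0`. -/
lemma exists_isIntegral_aeval_mul (hb : IntegralBasisData k₀ t b) {z : L}
    (hz : ∀ P : HeightOneSpectrum (intClosure k₀ t),
      IsPlaceOverZero t P → P.valuation L z ≤ 1) :
    ∃ s : k₀[X], s.eval 0 ≠ 0 ∧ IsIntegral (Algebra.adjoin k₀ {t}) (aeval t s * z) := by
  obtain ⟨a, ha, haz⟩ := hb.frac z
  obtain ⟨s, hs, hnd⟩ := exists_eq_pow_rootMultiplicity_mul_and_not_dvd a ha 0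
  rw [dvd_iff_isRoot, IsRoot] at hnd
  refine ⟨s, hnd, ?_⟩
  obtain ⟨y, hy⟩ := HeightOneSpectrum.mem_integers_of_valuation_le_one
    (R := intClosure k₀ t) L (aeval t s * z) (fun P => by
      by_cases hP : IsPlaceOverZero t P
      · rw [map_mul]
        exact mul_le_one' (val_le_one_of_isIntegral P (isIntegral_aeval t s)) (hz P hP)
      · have ht1 : P.valuation L t = 1 :=
          le_antisymm (val_le_one_of_isIntegral P isIntegral_t) (not_lt.1 hP)
        have := val_le_one_of_isIntegral P haz
        rw [hs] at this
        simpa [ht1] using this)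
  rw [← hy]
  exact y.2

lemma exists_hasCoordsAtZero (hb : IntegralBasisData k₀ t b) {z : L}
    (hz : ∀ P : HeightOneSpectrum (intClosure k₀ t),
      IsPlaceOverZero t P → P.valuation L z ≤ 1) :
    ∃ c : Fin d → k₀, HasCoordsAtZero t b z c := by
  obtain ⟨s, hs, hint⟩ := exists_isIntegral_aeval_mul hb hz
  obtain ⟨n, hn⟩ := hb.exists_coords hint
  exact ⟨fun i => (s.eval 0)⁻¹ * (n i).eval 0, s, n, hs, hn, fun i => by field_simp⟩

lemma val_algebraMap_eq_one (P : HeightOneSpectrum (intClosure k₀ t))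
    {c : k₀} (hc : c ≠ 0) : P.valuation L (algebraMap k₀ L c) = 1 := by
  have h : ∀ c : k₀, P.valuation L (algebraMap k₀ L c) ≤ 1 := fun c =>
    val_le_one_of_isIntegral P (by simpa using isIntegral_aeval t (C c))
  refine le_antisymm (h c) ?_
  have h1 : P.valuation L (algebraMap k₀ L c) * P.valuation L (algebraMap k₀ L c⁻¹) = 1 := by
    rw [← map_mul, ← map_mul, mul_inv_cancel₀ hc, map_one, map_one]
  rw [← h1]
  exact mul_le_of_le_one_right' (h c⁻¹)

/-- The residue field of a place over `t = 0` is algebraic over the field of constants. -/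
lemma hasSeparableResidue_of_notMem [CharZero k₀]
    {P : HeightOneSpectrum (intClosure k₀ t)}
    (hP : IsPlaceOverZero t P) {x : intClosure k₀ t}
    (hx : x ∉ P.asIdeal) : HasSeparableResidue k₀ (P.valuation L) (x : L) := by
  set τ : intClosure k₀ t := ⟨t, isIntegral_t⟩ with hτ
  have hτP : τ ∈ P.asIdeal := (P.valuation_lt_one_iff_mem τ).1 hP
  have := P.isPrime
  set π := Ideal.Quotient.mk P.asIdeal with hπ
  have hmap : ∀ q : k₀[X], ∀ y : intClosure k₀ t,
      ((aeval y q : intClosure k₀ t) : L) = aeval (y : L) q := fun q y =>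
    (aeval_algebraMap_apply L y q).symm
  have hmap' : ∀ q : k₀[X], ∀ y : intClosure k₀ t, π (aeval y q) = aeval (π y) q := fun q y =>
    (aeval_algebraMap_apply (intClosure k₀ t ⧸ P.asIdeal) y q).symm
  have hA0 : ∀ a : Algebra.adjoin k₀ {t},
      π (algebraMap (Algebra.adjoin k₀ {t}) (intClosure k₀ t) a) ∈
        Set.range (algebraMap k₀ (intClosure k₀ t ⧸ P.asIdeal)) := by
    intro a
    obtain ⟨q, hq⟩ := exists_aeval_eq a
    have h1 : algebraMap (Algebra.adjoin k₀ {t}) (intClosure k₀ t) a = aeval τ q := by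
      apply Subtype.ext
      rw [hmap]; exact hq.symm
    refine ⟨q.eval 0, ?_⟩
    rw [h1, hmap', show π τ = 0 from Ideal.Quotient.eq_zero_iff_mem.2 hτP,
      ← map_zero (algebraMap k₀ (intClosure k₀ t ⧸ P.asIdeal)), aeval_algebraMap_apply,
      coe_aeval_eq_eval]
  have hint : IsIntegral k₀ (π x) := by
    obtain ⟨p, hpm, hp⟩ := (integralClosure.isIntegral x : IsIntegral (Algebra.adjoin k₀ {t}) x)
    obtain ⟨q, hq, -, hqm⟩ := lifts_and_natDegree_eq_and_monic
      (f := algebraMap k₀ (intClosure k₀ t ⧸ P.asIdeal))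
      (p := p.map (π.comp (algebraMap (Algebra.adjoin k₀ {t}) (intClosure k₀ t))))
      ((lifts_iff_coeff_lifts _).2 fun n => by rw [coeff_map]; exact hA0 _) (hpm.map _)
    refine ⟨q, hqm, ?_⟩
    rw [← eval_map, hq, eval_map, ← hom_eval₂, hp, map_zero]
  refine ⟨(P.valuation_eq_one_iff_notMem).2 hx, minpoly k₀ (π x), ?_, ?_⟩
  · rw [← hmap]
    refine (P.valuation_lt_one_iff_mem _).2 ?_
    rw [← Ideal.Quotient.eq_zero_iff_mem]
    change π _ = 0
    rw [hmap', minpoly.aeval]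
  · rw [← hmap]
    refine (P.valuation_eq_one_iff_notMem).2 ?_
    rw [← Ideal.Quotient.eq_zero_iff_mem]
    change π _ ≠ 0
    rw [hmap']
    exact (minpoly.irreducible hint).separable.aeval_derivative_ne_zero (minpoly.aeval _ _)

lemma exists_localData [CharZero k₀] (hb : IntegralBasisData k₀ t b) {δ : Derivation k₀ L L}
    (hδ : δ t = t) {P : HeightOneSpectrum (intClosure k₀ t)}
    (hP : IsPlaceOverZero t P) : ∃ e, LocalData (P.valuation L) δ t e := by
  obtain ⟨κ, hκ⟩ := exists_val_eq_exp (v := P.valuation L) hb.t_ne_zero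
  have hκ0 : 0 < κ := by
    have h1 : P.valuation L t < 1 := hP
    rw [hκ, ← exp_zero, exp_lt_exp] at h1
    omega
  refine ⟨κ.toNat, fun c hc => val_algebraMap_eq_one P hc, hδ, by omega, ?_, fun u hu => ?_⟩
  · rw [hκ, Int.toNat_of_nonneg hκ0.le]
  · obtain ⟨n, d, hnd⟩ := P.exists_primeCompl_mul_eq_of_integer u hu.le
    have hd : (d : intClosure k₀ t) ∉ P.asIdeal := d.2
    have hn : n ∉ P.asIdeal := by
      rw [← P.valuation_eq_one_iff_notMem (K := L), ← hnd, map_mul, hu, one_mul,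
        P.valuation_eq_one_iff_notMem]
      exact hd
    exact ⟨_, _, hnd, hasSeparableResidue_of_notMem hP hn, hasSeparableResidue_of_notMem hP hd⟩

/-- The derivation `δ` has a bounded pole at each place, since the integral closure is finitely
generated over `k₀[t]`. -/
lemma exists_val_deriv_bound (hb : IntegralBasisData k₀ t b) {δ : Derivation k₀ L L}
    (hδ : δ t = t) (P : HeightOneSpectrum (intClosure k₀ t)) :
    ∃ m : ℕ, ∀ a, P.valuation L (δ a) ≤ P.valuation L a * exp (m : ℤ) := by
  set v := P.valuation L with hv
  obtain ⟨N, hN⟩ := exists_le_exp_natCast fun j => v (δ (b j))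
  have hone : ∀ n : ℕ, (1 : ℤᵐ⁰) ≤ exp (n : ℤ) := fun n => by
    rw [← exp_zero, exp_le_exp]; positivity
  have hint : ∀ x, IsIntegral (Algebra.adjoin k₀ {t}) x → v (δ x) ≤ exp (N : ℤ) := by
    intro x hx
    obtain ⟨n, rfl⟩ := hb.exists_coords hx
    rw [map_sum]
    refine v.map_sum_le fun i _ => ?_
    rw [Derivation.leibniz, deriv_aeval hδ, smul_eq_mul, smul_eq_mul]
    refine v.map_add_le ?_ ?_
    · rw [map_mul]
      exact (mul_le_of_le_one_left' (val_le_one_of_isIntegral P (isIntegral_aeval t _))).trans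
        (hN i)
    · rw [map_mul]
      exact (mul_le_one' (val_le_one_of_isIntegral P (hb.isIntegral_basis i))
        (val_le_one_of_isIntegral P (isIntegral_aeval t _))).trans (hone N)
  have hunit : ∀ u, v u = 1 → v (δ u) ≤ exp (N : ℤ) := by
    intro u hu
    obtain ⟨n, d, hnd⟩ := P.exists_primeCompl_mul_eq_of_integer u hu.le
    have hd : v (algebraMap _ L (d : intClosure k₀ t)) = 1 :=
      P.valuation_eq_one_iff_notMem.2 d.2
    have h1 : δ u * algebraMap _ L (d : intClosure k₀ t) =
        δ (algebraMap _ L n) -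
          u * δ (algebraMap _ L (d : intClosure k₀ t)) := by
      rw [← hnd, Derivation.leibniz, smul_eq_mul, smul_eq_mul]; ring
    have h2 := congrArg v h1
    rw [map_mul, hd, mul_one] at h2
    rw [h2]
    refine v.map_sub_le (hint _ n.2) ?_
    rw [map_mul, hu, one_mul]
    exact hint _ d.1.2
  obtain ⟨π, hπ⟩ := P.valuation_exists_uniformizer L
  have hπ0 : π ≠ 0 := by
    rintro rfl
    rw [map_zero] at hπ
    exact exp_ne_zero hπ.symm
  obtain ⟨N', hN'⟩ := exists_le_exp_natCast fun _ : Unit => v (δ π)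
  refine ⟨N + (N' + 1), fun a => ?_⟩
  rcases eq_or_ne a 0 with rfl | ha
  · simp
  obtain ⟨κ, hκ⟩ := exists_val_eq_exp (v := v) ha
  have hvπ : ∀ n : ℤ, v (π ^ n) = exp (-n) := fun n => by
    rw [map_zpow₀, hv, hπ, ← exp_zsmul]; simp
  set u := a * π ^ (-κ) with hu
  have hu1 : v u = 1 := by rw [hu, map_mul, hκ, hvπ, ← exp_add, exp_eq_one]; ring
  have hau : a = u * π ^ κ := by rw [hu, mul_assoc, ← zpow_add₀ hπ0]; simp
  have hδa : δ a = u * (κ * (π ^ (κ - 1) * δ π)) + π ^ κ * δ u := by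
    conv_lhs => rw [hau]
    rw [Derivation.leibniz, Derivation.leibniz_zpow]
    simp [smul_eq_mul, zsmul_eq_mul]
  rw [hδa, hκ]
  refine v.map_add_le ?_ ?_
  · rw [map_mul, hu1, one_mul, map_mul]
    have hκ1 : v (κ : L) ≤ 1 :=
      val_le_one_of_isIntegral P (by simpa using isIntegral_aeval t ((κ : ℤ) : k₀[X]))
    refine (mul_le_of_le_one_left' hκ1).trans ?_
    rw [map_mul, hvπ]
    refine (mul_le_mul_right (hN' ()) _).trans ?_
    rw [← exp_add, ← exp_add, exp_le_exp]
    push_cast; linarith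
  · rw [map_mul, hvπ]
    refine (mul_le_mul_right (hunit u hu1) _).trans ?_
    rw [← exp_add, ← exp_add, exp_le_exp]
    push_cast; linarith

end Places

lemma HasCoordsAtZero.deriv {δ : Derivation k₀ L L} (hδ : δ t = t)
    {M : Matrix (Fin d) (Fin d) k₀} (hM : ∀ j, HasCoordsAtZero t b (δ (b j)) fun i => M i j)
    {g : L} {c : Fin d → k₀} (h : HasCoordsAtZero t b g c) :
    HasCoordsAtZero t b (δ g) (M.mulVec c) := by
  have h' := h
  obtain ⟨s, n, hs, hg, hn⟩ := h'
  refine of_aeval_mul hs ?_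
  have e : aeval t s * δ g = (∑ i, (aeval t (derivative (n i) * X) * b i +
      aeval t (n i) * δ (b i))) + aeval t (-(derivative s * X)) * g := by
    have h1 := congrArg δ hg
    rw [map_sum, Derivation.leibniz, deriv_aeval hδ] at h1
    simp only [Derivation.leibniz, deriv_aeval hδ, smul_eq_mul] at h1
    rw [map_neg, neg_mul, ← sub_eq_add_neg, eq_sub_iff_add_eq, mul_comm _ g, h1]
    exact Finset.sum_congr rfl fun i _ => by ring
  rw [e]
  have h2 := (HasCoordsAtZero.sum Finset.univ fun i _ =>
    ((basis (t := t) (b := b) (k₀ := k₀) i).aeval_mul (derivative (n i) * X)).add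
      ((hM i).aeval_mul (n i))).add (h.aeval_mul (-(derivative s * X)))
  convert h2 using 1
  ext i
  simp [hn, Matrix.mulVec, dotProduct, Finset.mul_sum, Finset.sum_apply]
  exact Finset.sum_congr rfl fun j _ => by ring

lemma HasCoordsAtZero.aeval_deriv {δ : Derivation k₀ L L} (hδ : δ t = t)
    {M : Matrix (Fin d) (Fin d) k₀} (hM : ∀ j, HasCoordsAtZero t b (δ (b j)) fun i => M i j)
    (q : k₀[X]) {g : L} {c : Fin d → k₀} (h : HasCoordsAtZero t b g c) :
    HasCoordsAtZero t b (aeval (δ : Module.End k₀ L) q g) ((aeval M q).mulVec c) := by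
  induction q using Polynomial.induction_on' with
  | add f g hf hg =>
    rw [map_add, map_add, LinearMap.add_apply, Matrix.add_mulVec]
    exact hf.add hg
  | monomial n a =>
    have h1 : HasCoordsAtZero t b (((δ : Module.End k₀ L) ^ n) g) ((M ^ n).mulVec c) := by
      induction n with
      | zero => simpa using h
      | succ n ih =>
        rw [pow_succ', pow_succ', Module.End.mul_apply, ← Matrix.mulVec_mulVec]
        exact ih.deriv hδ hM
    rw [aeval_monomial, aeval_monomial, Module.End.mul_apply, Module.algebraMap_end_apply,
      ← Matrix.mulVec_mulVec, Algebra.algebraMap_eq_smul_one, Matrix.smul_mulVec,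
      Matrix.one_mulVec]
    simpa [Algebra.smul_def] using h1.aeval_mul (C a)

/-- With respect to an integral basis over `k₀[t]`, a derivation restricting to `t · d/dt` is
regular at `t = 0`; the matrix of its values at `t = 0` is killed by a product of polynomials with
roots `k / e`, `0 ≤ k < e`. -/
theorem exists_matrix_of_integralBasis [CharZero k₀] (hb : IntegralBasisData k₀ t b)
    {δ : Derivation k₀ L L} (hδ : δ t = t) :
    ∃ M : Matrix (Fin d) (Fin d) k₀, (∀ j, HasCoordsAtZero t b (δ (b j)) fun i => M i j) ∧
      ∃ E : Multiset ℕ, aeval M (E.map (ramPoly k₀)).prod = 0 := by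
  classical
  have := hb.isDedekindDomain
  have := hb.isFractionRing
  have hloc : ∀ P : HeightOneSpectrum (intClosure k₀ t), ∃ e, IsPlaceOverZero t P →
      LocalData (P.valuation L) δ t e := fun P => by
    by_cases hP : IsPlaceOverZero t P
    · obtain ⟨e, he⟩ := exists_localData hb hδ hP
      exact ⟨e, fun _ => he⟩
    · exact ⟨0, fun h => absurd h hP⟩
  choose e he using hloc
  have hδv : ∀ P : HeightOneSpectrum (intClosure k₀ t), IsPlaceOverZero t P →
      ∀ a, P.valuation L (δ a) ≤ P.valuation L a := fun P hP => by
    obtain ⟨m, hm⟩ := exists_val_deriv_bound hb hδ P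
    exact (he P hP).val_deriv_le m hm
  have hbv : ∀ (P : HeightOneSpectrum (intClosure k₀ t)) (j : Fin d), P.valuation L (b j) ≤ 1 :=
    fun P j => val_le_one_of_isIntegral P (hb.isIntegral_basis j)
  choose c hc using fun j => exists_hasCoordsAtZero hb (z := δ (b j))
    fun P hP => (hδv P hP _).trans (hbv P j)
  set M : Matrix (Fin d) (Fin d) k₀ := Matrix.of fun i j => c j i with hM
  have hMc : ∀ j, HasCoordsAtZero t b (δ (b j)) fun i => M i j := hc
  refine ⟨M, hMc, ?_⟩
  set S := (finite_isPlaceOverZero (k₀ := k₀) hb.t_ne_zero).toFinset with hS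
  refine ⟨S.val.map e, ?_⟩
  rw [Multiset.map_map]
  change aeval M (∏ P ∈ S, ramPoly k₀ (e P)) = 0
  set q := ∏ P ∈ S, ramPoly k₀ (e P) with hq
  -- Modulo `t`, the operator `q(δ)` kills `b j` at every place, that is,
  -- `q(δ) (b j) / t` is regular.
  have hcol : ∀ j, (aeval M q).mulVec (Pi.single j 1) = 0 := by
    intro j
    set g := aeval (δ : Module.End k₀ L) q (b j) with hg
    have h1 : HasCoordsAtZero t b g ((aeval M q).mulVec (Pi.single j 1)) :=
      (HasCoordsAtZero.basis j).aeval_deriv hδ hMc q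
    have h2 : ∀ P : HeightOneSpectrum (intClosure k₀ t), IsPlaceOverZero t P →
        P.valuation L (g / t) ≤ 1 := by
      intro P hP
      have hPS : P ∈ S := by simpa [hS] using hP
      rw [map_div₀]
      refine div_le_one_of_le₀ ?_ zero_le
      rw [hg, hq, ← Finset.mul_prod_erase S _ hPS, map_mul, Module.End.mul_apply]
      exact (he P hP).val_aeval_ramPoly_le (hδv P hP)
        ((he P hP).val_aeval_le_one (hδv P hP) _ (hbv P j))
    obtain ⟨c', hc'⟩ := exists_hasCoordsAtZero hb h2
    have h3 := hc'.aeval_mul X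
    rw [aeval_X, mul_div_cancel₀ _ hb.t_ne_zero, eval_X, zero_smul] at h3
    exact h1.unique hb h3
  ext i j
  have := congrFun (hcol j) i
  simpa using this

end IntegralBasis

/-! ### The squarefree part of the discriminant -/

section SquarefreePart

variable {R : Type*} [CommRing R]

lemma pow_dvd_derivative_of_pow_succ_dvd {π f : R[X]} {m : ℕ} (h : π ^ (m + 1) ∣ f) :
    π ^ m ∣ derivative f := by
  obtain ⟨g, rfl⟩ := h
  rw [derivative_mul, derivative_pow_succ]
  refine dvd_add ⟨C (m + 1 : R) * derivative π * g, by ring⟩ ⟨π * derivative g, by ring⟩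

variable [IsDomain R] [UniqueFactorizationMonoid R]

lemma IsSquarefreePart.squarefree {Δ r : R[X]} (hΔ : Δ ≠ 0) (h : IsSquarefreePart Δ r) :
    Squarefree r := by
  obtain ⟨g, -, -, hg, hgr⟩ := h
  have hr : r ≠ 0 := by rintro rfl; simp [hΔ] at hgr
  rw [squarefree_iff_irreducible_sq_not_dvd_of_ne_zero hr]
  intro π hπ hππ
  have hπp := hπ.prime
  obtain ⟨f, hf, hnd⟩ := (FiniteMultiplicity.of_prime_left hπp hΔ).exists_eq_pow_mul_and_not_dvd
  rcases Nat.eq_zero_or_pos (multiplicity π Δ) with h0 | h0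
  · rw [h0, pow_zero, one_mul] at hf
    exact hnd (hf ▸ hgr ▸ ((dvd_mul_right π π).trans hππ).mul_left g)
  · obtain ⟨n, hn⟩ := Nat.exists_eq_add_one.2 h0
    rw [hn] at hf
    have hΔd : π ^ (n + 1) ∣ Δ := ⟨f, hf⟩
    have hπg : π ^ n ∣ g :=
      hg _ ((pow_dvd_pow π n.le_succ).trans hΔd) (pow_dvd_derivative_of_pow_succ_dvd hΔd)
    have h2 : π ^ (n + 1) * π ∣ π ^ (n + 1) * f := by
      rw [← hf]
      conv_rhs => rw [hgr]
      have := mul_dvd_mul hπg hππ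
      convert this using 1
      ring
    exact hnd ((mul_dvd_mul_iff_left (pow_ne_zero _ hπ.ne_zero)).1 h2)

/-- In characteristic zero the squarefree part of a polynomial without constant factors has all
its prime factors. -/
lemma IsSquarefreePart.exists_dvd_pow [CharZero R] {Δ r : R[X]} (hΔ : Δ ≠ 0)
    (h : IsSquarefreePart Δ r) (hprim : ∀ c : R, ¬ IsUnit c → ¬ C c ∣ Δ) : ∃ N, Δ ∣ r ^ N := by
  have key : ∀ π, Prime π → π ∣ Δ → π ∣ r := by
    intro π hπ hπΔ
    obtain ⟨g, -, hgΔ', hg, hgr⟩ := h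
    by_contra hπr
    obtain ⟨f, hf, hnd⟩ :=
      (FiniteMultiplicity.of_prime_left hπ hΔ).exists_eq_pow_mul_and_not_dvd
    have h0 : multiplicity π Δ ≠ 0 := fun h0 => by
      rw [h0, pow_zero, one_mul] at hf
      exact hnd (hf ▸ hπΔ)
    obtain ⟨n, hn⟩ := Nat.exists_eq_succ_of_ne_zero h0
    rw [hn] at hf
    have hπg : π ^ (n + 1) ∣ g :=
      hπ.pow_dvd_of_dvd_mul_right _ hπr (hgr ▸ ⟨f, hf⟩)
    have h1 : π ^ (n + 1) ∣ derivative Δ := hπg.trans hgΔ'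
    have h2 : derivative Δ = π ^ n * (C (n + 1 : R) * derivative π * f) +
        π ^ (n + 1) * derivative f := by
      conv_lhs => rw [hf]
      rw [Nat.succ_eq_add_one, derivative_mul, derivative_pow_succ]; ring
    rw [h2, dvd_add_left (dvd_mul_right _ _), pow_succ,
      mul_dvd_mul_iff_left (pow_ne_zero _ hπ.ne_zero)] at h1
    have h3 := (hπ.dvd_or_dvd h1).resolve_right hnd
    by_cases hdeg : π.natDegree = 0
    · rw [natDegree_eq_zero] at hdeg
      obtain ⟨c, rfl⟩ := hdeg
      exact hprim c (fun hc => hπ.not_isUnit (hc.map C)) hπΔ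
    · have h4 : derivative π ≠ 0 := fun h0 => hdeg (derivative_eq_zero.1 h0)
      have h5 : C (n + 1 : R) * derivative π ≠ 0 :=
        mul_ne_zero (by rw [Ne, C_eq_zero]; exact_mod_cast n.succ_ne_zero) h4
      have h6 := natDegree_le_of_dvd h3 h5
      have h7 := natDegree_derivative_lt hdeg
      have h8 := natDegree_C_mul_le (n + 1 : R) (derivative π)
      omega
  clear h hprim
  induction Δ using UniqueFactorizationMonoid.induction_on_prime with
  | h₁ => exact absurd rfl hΔ
  | h₂ x hx => exact ⟨0, by simpa using hx.dvd⟩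
  | h₃ a π ha hπ ih =>
    obtain ⟨N, hN⟩ := ih ha fun π' hπ' h' => key π' hπ' (h'.mul_left _)
    exact ⟨N + 1, by
      rw [pow_succ', mul_comm π]
      exact mul_comm a π ▸ mul_dvd_mul (key π hπ (dvd_mul_right _ _)) hN⟩

end SquarefreePart

/-! ### Unramified divisors on the projective line -/

section Unramified

variable {R : Type*} [CommRing R]

lemma aeval_add_eps {S : Type*} [CommRing S] [Algebra R S] (x : S) (f : R[X]) :
    aeval (TrivSqZeroExt.inl x + TrivSqZeroExt.inr 1 : TrivSqZeroExt S S) f =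
      TrivSqZeroExt.inl (aeval x f) + TrivSqZeroExt.inr (aeval x (derivative f)) := by
  induction f using Polynomial.induction_on with
  | C a =>
    rw [aeval_C, aeval_C, derivative_C, map_zero, TrivSqZeroExt.inr_zero, add_zero]
    rfl
  | add f g hf hg => rw [map_add, hf, hg]; ext <;> simp
  | monomial n a ih =>
    rw [pow_succ, ← mul_assoc, map_mul, ih]
    ext
    · simp
    · simp [derivative_mul]
      ring

/-- A formally unramified closed subscheme of the affine line contains no tangent vector. -/
lemma subsingleton_of_formallyUnramified {I : Ideal R[X]}
    [Algebra.FormallyUnramified R (R[X] ⧸ I)] {S : Type*} [CommRing S] [Algebra R S] (x : S)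
    (h : ∀ f ∈ I, aeval x f = 0 ∧ aeval x (derivative f) = 0) : Subsingleton S := by
  let g₁ : (R[X] ⧸ I) →ₐ[R] TrivSqZeroExt S S := Ideal.Quotient.liftₐ I
    (aeval (TrivSqZeroExt.inl x + TrivSqZeroExt.inr 1)) fun f hf => by
      rw [aeval_add_eps, (h f hf).1, (h f hf).2]; simp
  let g₂ : (R[X] ⧸ I) →ₐ[R] TrivSqZeroExt S S := Ideal.Quotient.liftₐ I
    ((TrivSqZeroExt.inlAlgHom R S S).comp (aeval x)) fun f hf => by
      rw [AlgHom.comp_apply, (h f hf).1, map_zero]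
  have hker : IsNilpotent (TrivSqZeroExt.kerIdeal S S) := ⟨2, TrivSqZeroExt.kerIdeal_sq S S⟩
  have heq : g₁ = g₂ := Algebra.FormallyUnramified.ext _ hker fun y => by
    obtain ⟨f, rfl⟩ := Ideal.Quotient.mk_surjective y
    rw [Ideal.Quotient.mk_eq_mk_iff_sub_mem, TrivSqZeroExt.kerIdeal, RingHom.mem_ker]
    change TrivSqZeroExt.fst (aeval (TrivSqZeroExt.inl x + TrivSqZeroExt.inr 1) f -
      TrivSqZeroExt.inl (aeval x f)) = 0
    rw [aeval_add_eps]
    simp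
  have h1 : aeval (TrivSqZeroExt.inl x + TrivSqZeroExt.inr 1 : TrivSqZeroExt S S) (X : R[X]) =
      TrivSqZeroExt.inl (aeval x (X : R[X])) := DFunLike.congr_fun heq (Ideal.Quotient.mk I X)
  have h2 := congrArg TrivSqZeroExt.snd h1
  simp only [aeval_X, TrivSqZeroExt.snd_add, TrivSqZeroExt.snd_inl, TrivSqZeroExt.snd_inr,
    zero_add] at h2
  exact subsingleton_of_zero_eq_one h2.symm

/-- Étaleness in the chart with coordinate `x`: the polynomial `r` has no multiple roots, even
modulo `p`. -/
lemma ClosedInP1.isCoprime_derivative {D : ClosedInP1 R} {r : R[X]} (hD : D.IsSmoothDivisor)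
    (hr : D.ComplementIs r) (hrad : IsRadical r) : IsCoprime r (derivative r) := by
  have := hD.1
  have hI : D.idealX ≤ Ideal.span {r} := by
    have h1 := hr.1
    rw [← PrimeSpectrum.zeroLocus_span {r}, PrimeSpectrum.zeroLocus_eq_iff,
      (isRadical_iff_span_singleton.1 hrad).radical] at h1
    exact h1 ▸ Ideal.le_radical
  set J := Ideal.span {r, derivative r} with hJ
  have hs : Subsingleton (R[X] ⧸ J) := by
    refine subsingleton_of_formallyUnramified (I := D.idealX) (Ideal.Quotient.mk J X) fun f hf => ?_
    obtain ⟨g, rfl⟩ := Ideal.mem_span_singleton.1 (hI hf)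
    have hmk : ∀ f : R[X], aeval (Ideal.Quotient.mk J X) f = Ideal.Quotient.mk J f := fun f => by
      rw [← Ideal.Quotient.mkₐ_eq_mk R, aeval_algHom_apply, aeval_X_left_apply]
    rw [hmk, hmk, Ideal.Quotient.eq_zero_iff_mem, Ideal.Quotient.eq_zero_iff_mem, derivative_mul]
    have h1 : r ∈ J := Ideal.subset_span (by simp)
    have h2 : derivative r ∈ J := Ideal.subset_span (by simp)
    exact ⟨J.mul_mem_right _ h1, J.add_mem (J.mul_mem_right _ h2) (J.mul_mem_right _ h1)⟩
  have h1 : (1 : R[X]) ∈ J := by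
    rw [← Ideal.Quotient.eq_zero_iff_mem]; exact Subsingleton.elim _ _
  obtain ⟨a, b, hab⟩ := Ideal.mem_span_pair.1 h1
  exact ⟨a, b, hab⟩

/-- Étaleness in the chart with coordinate `t = 1 / x`: no root of `r` meets `∞` modulo `p`. -/
lemma ClosedInP1.isUnit_leadingCoeff [IsDomain R] [IsLocalRing R] {D : ClosedInP1 R} {r : R[X]}
    (hD : D.IsSmoothDivisor) (hr : D.ComplementIs r) (hr0 : r ≠ 0) :
    IsUnit r.leadingCoeff := by
  by_contra hnu
  have := hD.2
  have h1 := hr.2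
  rw [← PrimeSpectrum.zeroLocus_span {X * r.reverse}, PrimeSpectrum.zeroLocus_eq_iff] at h1
  set m := IsLocalRing.maximalIdeal R with hm
  have hs : Subsingleton (R ⧸ m) := by
    refine subsingleton_of_formallyUnramified (I := D.idealT) (0 : R ⧸ m) fun f hf => ?_
    have hf' : f ∈ (Ideal.span {X * r.reverse}).radical := h1 ▸ Ideal.le_radical hf
    obtain ⟨N, hN⟩ := hf'
    obtain ⟨g, hg⟩ := Ideal.mem_span_singleton.1 hN
    have hX : (X : R[X]) ∣ f :=
      prime_X.dvd_of_dvd_pow (n := N) ⟨r.reverse * g, by rw [hg]; ring⟩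
    obtain ⟨f₁, rfl⟩ := hX
    have hrX : ¬ (X : R[X]) ∣ r.reverse := by
      rw [X_dvd_iff, coeff_zero_reverse, leadingCoeff_eq_zero]; exact hr0
    have h2 : (X : R[X]) ^ N ∣ r.reverse * (X * g) := ⟨f₁ ^ N, by rw [← mul_pow, hg]; ring⟩
    obtain ⟨g', hg'⟩ := prime_X.pow_dvd_of_dvd_mul_left N hrX h2
    have h3 : f₁ ^ N = r.reverse * g' := by
      apply mul_left_cancel₀ (pow_ne_zero N (X_ne_zero (R := R)))
      rw [← mul_pow, hg]
      linear_combination r.reverse * hg'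
    have h4 : f₁.coeff 0 ∈ m := by
      have h5 := congrArg (fun q => Polynomial.coeff q 0) h3
      simp only [coeff_zero_eq_eval_zero, eval_pow, eval_mul] at h5
      rw [← coeff_zero_eq_eval_zero r.reverse, coeff_zero_reverse] at h5
      rw [coeff_zero_eq_eval_zero]
      refine Ideal.IsPrime.mem_of_pow_mem inferInstance N (h5 ▸ m.mul_mem_right _ ?_)
      exact (IsLocalRing.mem_maximalIdeal _).2 hnu
    have h0 : ∀ q : R[X], aeval (0 : R ⧸ m) q = Ideal.Quotient.mk m (q.coeff 0) := fun q => by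
      rw [aeval_def, eval₂_at_zero]; rfl
    rw [h0, h0]
    refine ⟨by simp, ?_⟩
    rw [Ideal.Quotient.eq_zero_iff_mem]
    simpa [derivative_mul] using h4
  exact (IsLocalRing.maximalIdeal.isMaximal R).ne_top (Ideal.Quotient.subsingleton_iff.1 hs)

end Unramified

/-! ### Integrality over `ℤ_q` -/

section Integrality

variable {p : ℕ} [Fact p.Prime] {k : Type u} [Field k] [CharP k p]

variable (p k) in
lemma charZero_Zq [PerfectRing k p] : CharZero (Zq p k) := by
  refine charZero_of_inj_zero fun n hn => ?_
  by_contra hn0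
  obtain ⟨a, m, hm, rfl⟩ := Nat.exists_eq_pow_mul_and_not_dvd hn0 p (Fact.out : p.Prime).ne_one
  rw [Nat.cast_mul, Nat.cast_pow] at hn
  rcases mul_eq_zero.1 hn with h | h
  · exact WittVector.p_nonzero p k (eq_zero_of_pow_eq_zero h)
  · have := congrArg (WittVector.constantCoeff : Zq p k →+* k) h
    rw [map_natCast, map_zero, CharP.cast_eq_zero_iff k p] at this
    exact hm this

/-- A rational number that is integral over `ℤ_q` is a `p`-adic integer. -/
lemma exists_padicInt_of_isIntegral [PerfectRing k p] {c : ℚ}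
    (hc : IsIntegral (Zq p k) (c : QqBar p k)) : ∃ z : ℤ_[p], (z : ℚ_[p]) = (c : ℚ_[p]) := by
  have := charZero_Zq p k
  have : CharZero (Qq p k) := charZero_of_injective_algebraMap
    (IsFractionRing.injective (Zq p k) (Qq p k))
  have hc' : IsIntegral (Zq p k) (c : Qq p k) := by
    rw [← isIntegral_algebraMap_iff (algebraMap (Qq p k) (QqBar p k)).injective, map_ratCast]
    exact hc
  obtain ⟨w, hw⟩ := IsIntegrallyClosed.isIntegral_iff.1 hc'
  have h1 : w * (c.den : Zq p k) = (c.num : Zq p k) := by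
    apply IsFractionRing.injective (Zq p k) (Qq p k)
    rw [map_mul, hw, map_natCast, map_intCast]
    exact_mod_cast Rat.mul_den_eq_num c
  have hp : ¬ p ∣ c.den := by
    intro hp
    have h2 := congrArg (WittVector.constantCoeff : Zq p k →+* k) h1
    rw [map_mul, map_natCast, map_intCast, (CharP.cast_eq_zero_iff k p _).2 hp, mul_zero, eq_comm,
      CharP.intCast_eq_zero_iff k p] at h2
    have h3 : p ∣ c.num.natAbs := Int.natCast_dvd.1 h2
    exact (Fact.out : p.Prime).ne_one
      (Nat.dvd_one.1 (c.reduced ▸ Nat.dvd_gcd h3 hp))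
  exact ⟨⟨c, Padic.norm_rat_le_one hp⟩, rfl⟩

lemma isIntegral_of_hasEigenvalue {R K : Type*} [CommRing R] [Field K] [Algebra R K] {d : ℕ}
    {M : Matrix (Fin d) (Fin d) K} (hM : ∀ i j, IsIntegral R (M i j)) {μ : K}
    (hμ : Module.End.HasEigenvalue (Matrix.toLin' M) μ) : IsIntegral R μ := by
  set M' : Matrix (Fin d) (Fin d) (integralClosure R K) := Matrix.of fun i j => ⟨M i j, hM i j⟩
  have hMM : M = M'.map (algebraMap (integralClosure R K) K) := by ext; rfl
  have h1 : IsIntegral (integralClosure R K) μ := by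
    refine ⟨M'.charpoly, M'.charpoly_monic, ?_⟩
    rw [← eval_map, ← Matrix.charpoly_map, ← hMM]
    have := (Module.End.hasEigenvalue_iff_isRoot_charpoly _ _).1 hμ
    rwa [Matrix.charpoly_toLin', IsRoot] at this
  exact isIntegral_trans μ h1

/-- The value at `x₀` of a function `f = N / ((x - x₀) ^ m s)` with `N ∈ R[x]` is integral over
`R`, if it is finite and if `x₀` and `1 / s(x₀)` are integral: it is the coefficient of
`(x - x₀) ^ m` in the Taylor expansion of `N`, divided by `s(x₀)`. -/
lemma isIntegral_eval_of_mul_eq {R K : Type*} [CommRing R] [Field K] [Algebra R K]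
    {h : RatFunc K} {x₀ : K} (hx₀ : IsIntegral R x₀) {m : ℕ} {s : K[X]} {N : R[X]}
    (hs : ∃ v, IsIntegral R v ∧ s.eval x₀ * v = 1)
    (hN : h * algebraMap K[X] (RatFunc K) ((X - C x₀) ^ m * s) =
      algebraMap K[X] (RatFunc K) (N.map (algebraMap R K)))
    (hh : h.denom.eval x₀ ≠ 0) : IsIntegral R (h.eval (RingHom.id K) x₀) := by
  obtain ⟨v, hv, hsv⟩ := hs
  have h1 := num_mul_eq_of_mul_eq hN
  have hcop : IsCoprime ((X - C x₀) ^ m) h.denom := by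
    refine IsCoprime.pow_left ?_
    rw [(irreducible_X_sub_C x₀).coprime_iff_not_dvd, dvd_iff_isRoot]
    exact hh
  obtain ⟨N', hN'⟩ : (X - C x₀) ^ m ∣ N.map (algebraMap R K) :=
    hcop.dvd_of_dvd_mul_right ⟨h.num * s, by rw [← h1]; ring⟩
  have h2 : h.num * s = N' * h.denom := by
    apply mul_left_cancel₀ (pow_ne_zero m (X_sub_C_ne_zero x₀))
    linear_combination h1 + h.denom * hN'
  have h3 : h.eval (RingHom.id K) x₀ = N'.eval x₀ * v := by
    rw [RatFunc.eval, eval₂_id, eval₂_id, div_eq_iff hh]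
    have := congrArg (Polynomial.eval x₀) h2
    rw [eval_mul, eval_mul] at this
    linear_combination v * this - h.num.eval x₀ * hsv
  have h4 : N'.eval x₀ = aeval x₀ (hasseDeriv m N) := by
    have h5 : (taylor x₀ (N.map (algebraMap R K))).coeff m = N'.eval x₀ := by
      rw [hN', taylor_mul, taylor_pow, map_sub, taylor_X, taylor_C, add_sub_cancel_right,
        coeff_X_pow_mul', if_pos le_rfl, Nat.sub_self, taylor_coeff_zero]
    rw [← h5, taylor_coeff, aeval_def, ← eval_map]
    congr 1
    ext n
    simp [hasseDeriv_coeff]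
  rw [h3, h4]
  have h6 : IsIntegral R (aeval x₀ (hasseDeriv m N)) :=
    adjoin_le_integralClosure hx₀ (aeval_mem_adjoin_singleton R x₀)
  exact h6.mul hv

end Integrality

/-! ### Discriminants -/

section Discriminant

variable {R : Type*} [CommRing R]

lemma exists_mul_add_mul_derivative_eq_C_discr {F : R[X]} (hF : F.Monic) (h0 : 0 < F.natDegree) :
    ∃ A B : R[X], F * A + derivative F * B = C F.discr := by
  obtain ⟨A, B, -, -, h⟩ := exists_mul_add_mul_eq_C_resultant F (derivative F)
    (m := F.natDegree) (n := F.natDegree - 1) le_rfl (natDegree_derivative_le F)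
    (Or.inl h0.ne')
  rw [resultant_deriv (natDegree_pos_iff_degree_pos.1 h0), hF.leadingCoeff, mul_one] at h
  set ε := F.natDegree * (F.natDegree - 1) / 2
  refine ⟨C ((-1) ^ ε) * A, C ((-1) ^ ε) * B, ?_⟩
  have : (-1 : R) ^ ε * (-1) ^ ε = 1 := by rw [← mul_pow]; simp
  have h2 : F * (C ((-1) ^ ε) * A) + derivative F * (C ((-1) ^ ε) * B) =
      C ((-1) ^ ε) * (F * A + derivative F * B) := by ring
  rw [h2, h, ← C_mul, ← mul_assoc, this, one_mul]

lemma map_discr_ne_zero {S E : Type*} [CommRing S] [Field E] {F : R[X]} (hF : F.Monic)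
    (h0 : 0 < F.natDegree) (φ : R →+* S) (ψ : S →+* E)
    (hsep : ((F.map φ).map ψ).Separable) : φ F.discr ≠ 0 := by
  intro h
  rw [Polynomial.map_map] at hsep
  set f := F.map (ψ.comp φ) with hf
  have hfm : f.Monic := hF.map _
  have hfd : f.natDegree = F.natDegree := hF.natDegree_map _
  have h1 : f.resultant (derivative f) F.natDegree (F.natDegree - 1) = 0 := by
    rw [hf, derivative_map, resultant_map_map, resultant_deriv (natDegree_pos_iff_degree_pos.1 h0)]
    simp [h]
  have h2 : (derivative f).natDegree ≤ F.natDegree - 1 := hfd ▸ natDegree_derivative_le f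
  obtain ⟨n, hn⟩ := Nat.exists_eq_add_of_le h2
  rw [hn, resultant_add_right_deg _ _ _ _ n le_rfl, ← hfd, coeff_natDegree, hfm.leadingCoeff,
    one_pow, one_mul] at h1
  exact (resultant_eq_zero_iff.1 h1).2 hsep

lemma isCoprime_map_derivative {E : Type*} [Field E] {F : R[X]} (hF : F.Monic)
    (h0 : 0 < F.natDegree) (φ : R →+* E) (hφ : φ F.discr ≠ 0) :
    IsCoprime (F.map φ) ((derivative F).map φ) := by
  obtain ⟨A, B, h⟩ := exists_mul_add_mul_derivative_eq_C_discr hF h0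
  have h1 := congrArg (Polynomial.map φ) h
  simp only [Polynomial.map_add, Polynomial.map_mul, map_C] at h1
  refine ⟨C (φ F.discr)⁻¹ * A.map φ, C (φ F.discr)⁻¹ * B.map φ, ?_⟩
  have : C (φ F.discr)⁻¹ * A.map φ * F.map φ + C (φ F.discr)⁻¹ * B.map φ * (derivative F).map φ =
      C (φ F.discr)⁻¹ * (F.map φ * A.map φ + (derivative F).map φ * B.map φ) := by ring
  rw [this, h1, ← C_mul, inv_mul_cancel₀ hφ, C_1]

end Discriminant

/-! ### The function field and its derivation -/

section FunctionField

variable {p : ℕ} [Fact p.Prime] {k : Type u} [Field k] [CharP k p]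

variable (p k) in
lemma charZero_Qq [PerfectRing k p] : CharZero (Qq p k) :=
  have := charZero_Zq p k
  charZero_of_injective_algebraMap (IsFractionRing.injective (Zq p k) (Qq p k))

lemma polyToRat_apply (f : (Zq p k)[X]) : polyToRat p k f =
    algebraMap (Qq p k)[X] (RatFunc (Qq p k)) (f.map (algebraMap (Zq p k) (Qq p k))) := rfl

variable (p k) in
lemma polyToRat_injective : Function.Injective (polyToRat p k) :=
  (RatFunc.algebraMap_injective _).comp
    (Polynomial.map_injective _ (IsFractionRing.injective (Zq p k) (Qq p k)))

lemma exists_eq_polyToRat_div (z : RatFunc (Qq p k)) :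
    ∃ a b, z = polyToRat p k a / polyToRat p k b := by
  have key : ∀ f : (Qq p k)[X], ∃ (c : Zq p k) (g : (Zq p k)[X]), c ≠ 0 ∧
      polyToRat p k g = polyToRat p k (C c) * algebraMap _ (RatFunc (Qq p k)) f := fun f => by
    obtain ⟨c, hc, h⟩ := IsLocalization.integerNormalization_spec
      (M := nonZeroDivisors (Zq p k)) f
    refine ⟨c, IsLocalization.integerNormalization (nonZeroDivisors (Zq p k)) f,
      nonZeroDivisors.ne_zero hc, ?_⟩
    rw [polyToRat_apply, h, polyToRat_apply, ← map_mul, map_C, Algebra.smul_def,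
      Polynomial.algebraMap_apply]
  obtain ⟨c, a, hc, ha⟩ := key z.num
  obtain ⟨c', b, hc', hb⟩ := key z.denom
  refine ⟨C c' * a, C c * b, ?_⟩
  have h0 : ∀ c : Zq p k, c ≠ 0 → polyToRat p k (C c) ≠ 0 := fun c hc =>
    (map_ne_zero_iff _ (polyToRat_injective p k)).2 (by simpa using hc)
  have hd : algebraMap _ (RatFunc (Qq p k)) z.denom ≠ 0 :=
    (map_ne_zero_iff _ (RatFunc.algebraMap_injective _)).2 z.denom_ne_zero
  rw [map_mul, map_mul, ha, hb]
  have h1 := h0 c hc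
  have h2 := h0 c' hc'
  conv_lhs => rw [← RatFunc.num_div_denom z]
  field_simp

/-- By Gauss's lemma a monic lift of an irreducible polynomial stays irreducible over `ℚ_q(x)`. -/
lemma IsMonicLift.irreducible [PerfectRing k p] {Q : k[X][X]} {F : (Zq p k)[X][X]}
    (hF : IsMonicLift Q F) (hQ : Irreducible Q) : Irreducible (F.map (polyToRat p k)) := by
  have h1 : Irreducible F := hF.monic.irreducible_of_irreducible_map _ F (hF.reduction ▸ hQ)
  let _ : Algebra (Zq p k)[X] (RatFunc (Qq p k)) := (polyToRat p k).toAlgebra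
  have : FaithfulSMul (Zq p k)[X] (RatFunc (Qq p k)) :=
    (faithfulSMul_iff_algebraMap_injective _ _).2 (polyToRat_injective p k)
  have : IsFractionRing (Zq p k)[X] (RatFunc (Qq p k)) :=
    IsFractionRing.of_field _ _ exists_eq_polyToRat_div
  exact (hF.monic.irreducible_iff_irreducible_map_fraction_map (K := RatFunc (Qq p k))).1 h1

/-- The element `x` of the function field. -/
abbrev funX (F : (Zq p k)[X][X]) : FunField F :=
  algebraMap (RatFunc (Qq p k)) (FunField F) RatFunc.X

variable {F : (Zq p k)[X][X]} [Fact (Irreducible (F.map (polyToRat p k)))]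

lemma finiteDimensional_funField : FiniteDimensional (RatFunc (Qq p k)) (FunField F) :=
  (AdjoinRoot.powerBasis (Fact.out : Irreducible (F.map (polyToRat p k))).ne_zero).finite

/-- The differentials of the function field are free on `dx`, because the function field is
formally étale over `ℚ_q[x]`. -/
lemma exists_kaehler_equiv [PerfectRing k p] :
    ∃ ψ : Ω[FunField F⁄Qq p k] ≃ₗ[FunField F] FunField F,
      ψ (KaehlerDifferential.D (Qq p k) (FunField F) (funX F)) = 1 := by
  have := charZero_Qq p k
  have := finiteDimensional_funField (F := F)
  have : CharZero (RatFunc (Qq p k)) :=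
    charZero_of_injective_algebraMap (algebraMap (Qq p k) (RatFunc (Qq p k))).injective
  have : Algebra.FormallyEtale (RatFunc (Qq p k)) (FunField F) :=
    Algebra.FormallyEtale.of_isSeparable (RatFunc (Qq p k)) (FunField F)
  have : Algebra.FormallyEtale (Qq p k)[X] (RatFunc (Qq p k)) :=
    .of_isLocalization (nonZeroDivisors _)
  have : Algebra.FormallyEtale (Qq p k)[X] (FunField F) :=
    .comp (Qq p k)[X] (RatFunc (Qq p k)) (FunField F)
  refine ⟨(KaehlerDifferential.tensorKaehlerEquivOfFormallyEtale (Qq p k) (Qq p k)[X]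
    (FunField F)).symm ≪≫ₗ (KaehlerDifferential.polynomialEquiv (Qq p k)).baseChange _ _ _ _ ≪≫ₗ
    TensorProduct.AlgebraTensorModule.rid _ _ _, ?_⟩
  have hx : funX F = algebraMap (Qq p k)[X] (FunField F) X := by
    rw [IsScalarTower.algebraMap_apply (Qq p k)[X] (RatFunc (Qq p k)) (FunField F),
      RatFunc.algebraMap_X]
  simp only [LinearEquiv.trans_apply]
  rw [hx, KaehlerDifferential.tensorKaehlerEquivOfFormallyEtale_symm_D_algebraMap]
  simp

/-- The derivation `d/dx` of the function field; in terms of it, `G` is the connection matrix of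
the family `b` when `D b_j = ∑ i, G i j * b_i`. -/
lemma exists_derivation [PerfectRing k p] :
    ∃ D : Derivation (Qq p k) (FunField F) (FunField F), D (funX F) = 1 ∧
      ∀ b G, IsConnectionMatrix F b G ↔ ∀ j, D (b j) = ∑ i, G i j • b i := by
  obtain ⟨ψ, hψ⟩ := exists_kaehler_equiv (F := F)
  refine ⟨ψ.toLinearMap.compDer (KaehlerDifferential.D (Qq p k) (FunField F)), hψ,
    fun b G => forall_congr' fun j => ?_⟩
  rw [← ψ.injective.eq_iff, map_sum]
  simp only [map_smul]
  rw [hψ]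
  simp [smul_eq_mul]

/-! ### Bases of the function field -/

/-- The powers of `y` as a basis of the function field. -/
def powerBasisFun (F : (Zq p k)[X][X]) [Fact (Irreducible (F.map (polyToRat p k)))]
    (hF : F.Monic) : Module.Basis (Fin F.natDegree) (RatFunc (Qq p k)) (FunField F) :=
  (AdjoinRoot.powerBasis' (hF.map (polyToRat p k))).basis.reindex
    (finCongr (by rw [AdjoinRoot.powerBasis'_dim, hF.natDegree_map]))

lemma powerBasisFun_apply (hF : F.Monic) (j : Fin F.natDegree) :
    powerBasisFun F hF j = powerFamily F j := by
  simp [powerBasisFun, powerFamily]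

lemma linearIndependent_powerFamily (hF : F.Monic) :
    LinearIndependent (RatFunc (Qq p k)) (powerFamily F) ∧
      ⊤ ≤ Submodule.span (RatFunc (Qq p k)) (Set.range (powerFamily F)) := by
  rw [← funext (powerBasisFun_apply hF)]
  exact ⟨(powerBasisFun F hF).linearIndependent, (powerBasisFun F hF).span_eq.ge⟩

lemma powerFamily_eq_sum (W : GL (Fin F.natDegree) (Zq p k)[T;T⁻¹]) (l : Fin F.natDegree) :
    powerFamily F l = ∑ m, laurentToRat p k (W⁻¹.val m l) • infinityFamily F W m := by
  have h1 : ∀ i, ∑ m, laurentToRat p k (W.val i m) * laurentToRat p k (W⁻¹.val m l) =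
      if i = l then 1 else 0 := fun i => by
    have h2 : W.val * W⁻¹.val = 1 := by simp
    have h3 := congrArg (laurentToRat p k) (congrFun (congrFun h2 i) l)
    rw [Matrix.mul_apply, map_sum, Matrix.one_apply] at h3
    simp only [map_mul] at h3
    rw [h3]
    split_ifs <;> simp
  simp only [infinityFamily, Finset.smul_sum, smul_smul]
  rw [Finset.sum_comm]
  simp only [← Finset.sum_smul]
  have h4 : ∀ i, ∑ m, laurentToRat p k (W⁻¹.val m l) * laurentToRat p k (W.val i m) =
      if i = l then 1 else 0 := fun i => by
    rw [← h1 i]; exact Finset.sum_congr rfl fun _ _ => by ring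
  simp only [h4, ite_smul, one_smul, zero_smul, Finset.sum_ite_eq', Finset.mem_univ, if_true]

lemma linearIndependent_infinityFamily (hF : F.Monic) (W : GL (Fin F.natDegree) (Zq p k)[T;T⁻¹]) :
    LinearIndependent (RatFunc (Qq p k)) (infinityFamily F W) ∧
      ⊤ ≤ Submodule.span (RatFunc (Qq p k)) (Set.range (infinityFamily F W)) := by
  have hspan : ⊤ ≤ Submodule.span (RatFunc (Qq p k)) (Set.range (infinityFamily F W)) := by
    rw [← (powerBasisFun F hF).span_eq, Submodule.span_le]
    rintro _ ⟨l, rfl⟩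
    rw [powerBasisFun_apply, powerFamily_eq_sum W]
    exact Submodule.sum_mem _ fun m _ => Submodule.smul_mem _ _ (Submodule.subset_span ⟨m, rfl⟩)
  refine ⟨linearIndependent_of_top_le_span_of_card_eq_finrank hspan ?_, hspan⟩
  rw [Module.finrank_eq_card_basis (powerBasisFun F hF)]

/-- Existence and uniqueness of the connection matrix of a basis. -/
lemma existsUnique_isConnectionMatrix [PerfectRing k p] {b : Fin F.natDegree → FunField F}
    (hb : LinearIndependent (RatFunc (Qq p k)) b)
    (hb' : ⊤ ≤ Submodule.span (RatFunc (Qq p k)) (Set.range b)) :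
    ∃! G : Matrix (Fin F.natDegree) (Fin F.natDegree) (RatFunc (Qq p k)),
      IsConnectionMatrix F b G := by
  obtain ⟨D, -, hD⟩ := exists_derivation (F := F)
  let B := Module.Basis.mk hb hb'
  have hB : ∀ i, B i = b i := fun i => by simp [B]
  refine ⟨Matrix.of fun i j => B.repr (D (b j)) i, (hD _ _).2 fun j => ?_, fun G hG => ?_⟩
  · simp_rw [← hB]
    exact (B.sum_repr _).symm
  · ext i j
    rw [Matrix.of_apply, (hD _ _).1 hG j]
    simp_rw [← hB]
    simp [Finsupp.single_apply]

end FunctionField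

/-! ### The connection matrix of the power basis -/

lemma ratFuncBaseChange_algebraMap {K E : Type*} [Field K] [Field E] [Algebra K E] (f : K[X]) :
    ratFuncBaseChange K E (algebraMap K[X] (RatFunc K) f) =
      algebraMap E[X] (RatFunc E) (f.map (algebraMap K E)) := by
  have := RatFunc.map_apply_div (R := E) (Polynomial.mapRingHom (algebraMap K E))
    (nonZeroDivisors_le_comap_nonZeroDivisors_of_injective _
      (Polynomial.map_injective _ (algebraMap K E).injective)) f 1
  rw [map_one, map_one, map_one, div_one, div_one] at this
  exact this

lemma derivative_eval_C {R : Type*} [CommRing R] (F : R[X][X]) (b : R) :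
    derivative (F.eval (C b)) = (xDeriv R F).eval (C b) := by
  rw [eval_eq_sum_range, eval_eq_sum_range' (n := F.natDegree + 1), derivative_sum]
  · refine Finset.sum_congr rfl fun i _ => ?_
    rw [coeff_xDeriv, ← C_pow, derivative_mul, derivative_C, mul_zero, add_zero]
  · rw [Nat.lt_succ_iff, natDegree_le_iff_coeff_eq_zero]
    intro n hn
    rw [coeff_xDeriv, coeff_eq_zero_of_natDegree_lt hn, derivative_zero]

/-- The residue at `x₀` of a function with denominator `Δ` is integral over `R` if the roots of
`Δ` are pairwise distinct, and distinct from `∞`, in every reduction. -/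
lemma isIntegral_residue {R K : Type*} [CommRing R] [Field K] [Algebra R K] {Δ r N : R[X]} {n : ℕ}
    (hr : IsCoprime r (derivative r)) (hlc : IsUnit r.leadingCoeff) (hΔr : Δ ∣ r ^ n)
    {g : RatFunc K} (hg : algebraMap K[X] (RatFunc K) (Δ.map (algebraMap R K)) * g =
      algebraMap K[X] (RatFunc K) (N.map (algebraMap R K))) {x₀ : K}
    (hh : ((RatFunc.X - RatFunc.C x₀) * g).denom.eval x₀ ≠ 0) :
    IsIntegral R (((RatFunc.X - RatFunc.C x₀) * g).eval (RingHom.id K) x₀) := by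
  have hX : RatFunc.X - RatFunc.C x₀ = algebraMap K[X] (RatFunc K) (X - C x₀) := by
    rw [map_sub, RatFunc.algebraMap_X, RatFunc.algebraMap_C]
  by_cases hΔ0 : (Δ.map (algebraMap R K)).eval x₀ = 0
  swap
  · have h1 := regular_of_mul_eq (h := (RatFunc.X - RatFunc.C x₀) * g)
      (s := Δ.map (algebraMap R K)) (N := (X - C x₀) * N.map (algebraMap R K)) (x₀ := x₀)
      (by rw [map_mul, ← hg, hX]; ring) hΔ0
    rw [h1.2]
    simp [isIntegral_zero]
  obtain ⟨Δ', hΔ'⟩ := hΔr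
  have hr0 : (r.map (algebraMap R K)).eval x₀ = 0 := by
    have h1 := congrArg (fun f => (f.map (algebraMap R K)).eval x₀) hΔ'
    simp only [Polynomial.map_mul, eval_mul, hΔ0, zero_mul, Polynomial.map_pow, eval_pow] at h1
    exact eq_zero_of_pow_eq_zero h1
  obtain ⟨s, hs⟩ := dvd_iff_isRoot.2 hr0
  obtain ⟨u, hu⟩ := hlc
  have hx₀ : IsIntegral R x₀ := by
    refine ⟨C (↑u⁻¹ : R) * r, monic_C_mul_of_mul_leadingCoeff_eq_one (by rw [← hu]; simp), ?_⟩
    rw [eval₂_mul, ← eval_map (p := r), hr0, mul_zero]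
  have hsx : s.eval x₀ = (derivative (r.map (algebraMap R K))).eval x₀ := by
    rw [hs]; simp
  obtain ⟨a, b, hab⟩ := hr
  have hsb : s.eval x₀ * aeval x₀ b = 1 := by
    have h1 := congrArg (fun f => (f.map (algebraMap R K)).eval x₀) hab
    simp only [Polynomial.map_add, Polynomial.map_mul, eval_add, eval_mul, hr0, mul_zero, zero_add,
      Polynomial.map_one, eval_one, ← derivative_map] at h1
    rw [hsx, mul_comm, ← h1, aeval_def, ← eval_map]
  have hb : IsIntegral R (aeval x₀ b) :=
    adjoin_le_integralClosure hx₀ (aeval_mem_adjoin_singleton R x₀)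
  refine isIntegral_eval_of_mul_eq hx₀ (m := n) (s := s ^ (n + 1)) (N := N * Δ' * r)
    ⟨aeval x₀ b ^ (n + 1), hb.pow _, by rw [eval_pow, ← mul_pow, hsb, one_pow]⟩ ?_ hh
  have h2 : (X - C x₀) * ((X - C x₀) ^ n * s ^ (n + 1)) =
      Δ.map (algebraMap R K) * (Δ'.map (algebraMap R K) * r.map (algebraMap R K)) := by
    rw [← mul_assoc (Δ.map _), ← Polynomial.map_mul, ← hΔ', Polynomial.map_pow, hs, mul_pow]
    ring
  calc _ = algebraMap K[X] (RatFunc K) ((X - C x₀) * ((X - C x₀) ^ n * s ^ (n + 1))) * g := by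
        rw [hX, map_mul _ (X - C x₀)]; ring
    _ = _ := by
        rw [h2, map_mul, mul_right_comm, hg, Polynomial.map_mul, Polynomial.map_mul, map_mul,
          map_mul, map_mul]
        ring

section PowerConnection

variable {p : ℕ} [Fact p.Prime] {k : Type u} [Field k] [CharP k p]

lemma ratFuncBaseChange_comp_polyToRat :
    (ratFuncBaseChange (Qq p k) (QqBar p k)).comp (polyToRat p k) =
      (algebraMap (QqBar p k)[X] (RatFunc (QqBar p k))).comp
        (mapRingHom (algebraMap (Zq p k) (QqBar p k))) := by
  refine RingHom.ext fun f => ?_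
  rw [RingHom.comp_apply, polyToRat_apply, ratFuncBaseChange_algebraMap, Polynomial.map_map,
    ← IsScalarTower.algebraMap_eq]
  rfl

/-- The discriminant is a common denominator of the connection matrix of the power basis. -/
lemma exists_discr_mul_eq {F : (Zq p k)[X][X]} (hF : F.Monic) (h0 : 0 < F.natDegree)
    (hΔ : F.discr ≠ 0)
    {G : Matrix (Fin F.natDegree) (Fin F.natDegree) (RatFunc (Qq p k))}
    (hG : PowerRel (polyToRat p k) F G) (i j : Fin F.natDegree) :
    ∃ N, polyToRat p k F.discr * G i j = polyToRat p k N := by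
  obtain ⟨A, B, h⟩ := exists_mul_add_mul_derivative_eq_C_discr hF h0
  refine ⟨_, hG.mul_apply hF rfl (isCoprime_map_derivative hF h0 _
    ((map_ne_zero_iff _ (polyToRat_injective p k)).2 hΔ)) (σ := F.discr)
    (w := -(B * xDeriv _ F)) (z := A * xDeriv _ F) ?_ i j⟩
  rw [← h]; ring

variable {F : (Zq p k)[X][X]} [Fact (Irreducible (F.map (polyToRat p k)))]
  {D : Derivation (Qq p k) (FunField F) (FunField F)}

lemma deriv_polyToRat (hD : D (funX F) = 1) (a : (Zq p k)[X]) :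
    D (algebraMap (RatFunc (Qq p k)) (FunField F) (polyToRat p k a)) =
      algebraMap (RatFunc (Qq p k)) (FunField F) (polyToRat p k (derivative a)) := by
  have key : ∀ q : (Qq p k)[X], algebraMap (RatFunc (Qq p k)) (FunField F)
      (algebraMap (Qq p k)[X] (RatFunc (Qq p k)) q) = aeval (funX F) q := fun q => by
    rw [aeval_algebraMap_apply, ← RatFunc.algebraMap_X, aeval_algebraMap_apply,
      aeval_X_left_apply]
  rw [polyToRat_apply, polyToRat_apply, key, key, Derivation.map_aeval, hD, derivative_map,
    smul_eq_mul, mul_one]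

lemma deriv_mk (hD : D (funX F) = 1) (f : (Zq p k)[X][X]) :
    D (AdjoinRoot.mk (F.map (polyToRat p k)) (f.map (polyToRat p k))) =
      AdjoinRoot.mk (F.map (polyToRat p k)) ((xDeriv _ f).map (polyToRat p k)) +
      AdjoinRoot.mk (F.map (polyToRat p k)) ((derivative f).map (polyToRat p k)) *
        D (AdjoinRoot.root (F.map (polyToRat p k))) := by
  induction f using Polynomial.induction_on' with
  | add f g hf hg => simp only [Polynomial.map_add, map_add, hf, hg]; ring
  | monomial n a =>
    have h1 : xDeriv (Zq p k) (monomial n a) = monomial n (derivative a) := by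
      ext1 j
      rw [coeff_xDeriv, coeff_monomial, coeff_monomial]
      split_ifs <;> simp
    have h2 : ∀ (m : ℕ) (a : (Zq p k)[X]), AdjoinRoot.mk (F.map (polyToRat p k))
        ((monomial m a).map (polyToRat p k)) =
        algebraMap (RatFunc (Qq p k)) (FunField F) (polyToRat p k a) *
          AdjoinRoot.root (F.map (polyToRat p k)) ^ m := fun m a => by
      rw [← C_mul_X_pow_eq_monomial, Polynomial.map_mul, map_C, Polynomial.map_pow, map_X, map_mul,
        map_pow, AdjoinRoot.mk_X, AdjoinRoot.mk_C]
      rfl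
    rw [h1, derivative_monomial, h2, h2, h2, Derivation.leibniz, deriv_polyToRat hD,
      Derivation.leibniz_pow, map_mul, map_mul, map_natCast, map_natCast]
    simp only [smul_eq_mul, nsmul_eq_mul]
    ring

/-- Differentiating `F(x, y) = 0` shows that a connection matrix of the power basis satisfies the
polynomial congruence `PowerRel`. -/
lemma powerRel_of_deriv (hD : D (funX F) = 1)
    {G : Matrix (Fin F.natDegree) (Fin F.natDegree) (RatFunc (Qq p k))}
    (hG : ∀ j, D (powerFamily F j) = ∑ i, G i j • powerFamily F i) :
    PowerRel (polyToRat p k) F G := by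
  intro j
  rw [← AdjoinRoot.mk_eq_zero]
  have h1 := deriv_mk hD F
  rw [AdjoinRoot.mk_self, map_zero] at h1
  have h2 : AdjoinRoot.mk (F.map (polyToRat p k)) (colPoly G j) = D (powerFamily F j) := by
    rw [hG, colPoly, map_sum]
    refine Finset.sum_congr rfl fun i _ => ?_
    rw [map_mul, map_pow, AdjoinRoot.mk_X, AdjoinRoot.mk_C, Algebra.smul_def]
    rfl
  rw [map_add, map_mul, h2, powerFamily, Derivation.leibniz_pow, map_mul, map_mul, map_pow,
    AdjoinRoot.mk_X, map_natCast]
  simp only [smul_eq_mul, nsmul_eq_mul]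
  linear_combination (-((j : ℕ) : FunField F) *
    AdjoinRoot.root (F.map (polyToRat p k)) ^ ((j : ℕ) - 1)) * h1

end PowerConnection

/-! ### The substitution `x ↦ 1/x` -/

section Inversion

variable {K : Type*} [Field K]

lemma transcendental_X_inv : Transcendental K (RatFunc.X : RatFunc K)⁻¹ := fun h =>
  RatFunc.transcendental_X (by simpa using h.inv)

variable (K) in
/-- The substitution `x ↦ 1/x` in rational functions. -/
def invRat : RatFunc K →+* RatFunc K :=
  IsFractionRing.lift (A := K[X]) (g := (aeval (RatFunc.X : RatFunc K)⁻¹ : K[X] →ₐ[K] _).toRingHom)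
    (transcendental_iff_injective.1 transcendental_X_inv)

lemma invRat_algebraMap (f : K[X]) :
    invRat K (algebraMap K[X] (RatFunc K) f) = aeval (RatFunc.X : RatFunc K)⁻¹ f :=
  IsFractionRing.lift_algebraMap _ _

lemma invRat_X : invRat K RatFunc.X = RatFunc.X⁻¹ := by
  rw [← RatFunc.algebraMap_X, invRat_algebraMap, aeval_X, RatFunc.algebraMap_X]

lemma invRat_C (c : K) : invRat K (RatFunc.C c) = RatFunc.C c := by
  rw [← RatFunc.algebraMap_C, invRat_algebraMap, aeval_C, RatFunc.algebraMap_C,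
    RatFunc.algebraMap_eq_C]

lemma aeval_X_eq_algebraMap (f : K[X]) :
    aeval (RatFunc.X : RatFunc K) f = algebraMap K[X] (RatFunc K) f := by
  rw [← RatFunc.algebraMap_X, aeval_algebraMap_apply, aeval_X_left_apply]

lemma invRat_aeval_X_inv (f : K[X]) :
    invRat K (aeval (RatFunc.X : RatFunc K)⁻¹ f) = algebraMap K[X] (RatFunc K) f := by
  rw [aeval_def, hom_eval₂, map_inv₀, invRat_X, inv_inv, ← aeval_X_eq_algebraMap, aeval_def]
  congr 1
  ext1 c
  rw [RingHom.comp_apply, RatFunc.algebraMap_eq_C, invRat_C]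

lemma eval_X_inv (g : RatFunc K) :
    g.eval (RatFunc.C : K →+* RatFunc K) RatFunc.X⁻¹ = invRat K g := by
  conv_rhs => rw [← RatFunc.num_div_denom g, map_div₀, invRat_algebraMap, invRat_algebraMap]
  rfl

lemma ratFuncBaseChange_X {E : Type*} [Field E] [Algebra K E] :
    ratFuncBaseChange K E RatFunc.X = RatFunc.X := by
  rw [← RatFunc.algebraMap_X, ratFuncBaseChange_algebraMap, map_X, RatFunc.algebraMap_X]

lemma ratFuncBaseChange_aeval_X_inv {E : Type*} [Field E] [Algebra K E] (f : K[X]) :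
    ratFuncBaseChange K E (aeval (RatFunc.X : RatFunc K)⁻¹ f) =
      aeval (RatFunc.X : RatFunc E)⁻¹ (f.map (algebraMap K E)) := by
  rw [aeval_def, hom_eval₂, map_inv₀, ratFuncBaseChange_X, aeval_def, eval₂_map]
  congr 1
  ext1 c
  rw [RingHom.comp_apply, RatFunc.algebraMap_eq_C, ← RatFunc.algebraMap_C,
    ratFuncBaseChange_algebraMap, map_C, RatFunc.algebraMap_C, RingHom.comp_apply,
    RatFunc.algebraMap_eq_C]

lemma substInv_residue (g : RatFunc K) :
    (RatFunc.X - RatFunc.C (0 : K)) *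
      (-((RatFunc.X : RatFunc K)⁻¹ ^ 2) * g.eval (RatFunc.C : K →+* RatFunc K) RatFunc.X⁻¹) =
    invRat K (-(RatFunc.X * g)) := by
  rw [eval_X_inv, map_neg, map_mul, invRat_X, map_zero, sub_zero]
  have := RatFunc.X_ne_zero (K := K)
  field_simp

/-- A function of `t = 1/x` whose residue is read off from a quotient of polynomials in `t` with
denominator not vanishing at `t = 0`. -/
lemma substInv_regular {E : Type*} [Field E] [Algebra K E] {g : RatFunc K} {s n : K[X]} {m : K}
    (hs : s.eval 0 ≠ 0) (hn : n.eval 0 = s.eval 0 * m)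
    (h : aeval (RatFunc.X : RatFunc K)⁻¹ s * -(RatFunc.X * g) =
      aeval (RatFunc.X : RatFunc K)⁻¹ n) :
    (invRat E (-(RatFunc.X * ratFuncBaseChange K E g))).denom.eval 0 ≠ 0 ∧
      (invRat E (-(RatFunc.X * ratFuncBaseChange K E g))).eval (RingHom.id E) 0 =
        algebraMap K E m := by
  have h1 := congrArg (invRat E) (congrArg (ratFuncBaseChange K E) h)
  rw [map_mul, map_mul, map_neg, map_mul, ratFuncBaseChange_aeval_X_inv, ratFuncBaseChange_X,
    ratFuncBaseChange_aeval_X_inv, invRat_aeval_X_inv, invRat_aeval_X_inv, mul_comm] at h1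
  have hev : ∀ q : K[X], (q.map (algebraMap K E)).eval 0 = algebraMap K E (q.eval 0) := fun q => by
    rw [← map_zero (algebraMap K E), eval_map_apply]
  have hs' : (s.map (algebraMap K E)).eval 0 ≠ 0 := by rw [hev]; simpa using hs
  have h2 := regular_of_mul_eq h1 hs'
  refine ⟨h2.1, h2.2.trans ?_⟩
  rw [hev, hev, hn, map_mul, mul_div_cancel_left₀]
  rwa [hev] at hs'

lemma aeval_X_inv_eq_reverse {R : Type*} [CommRing R] [Algebra R K] (f : R[X]) :
    aeval (RatFunc.X : RatFunc K)⁻¹ (f.map (algebraMap R K)) * RatFunc.X ^ f.natDegree =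
      algebraMap K[X] (RatFunc K) (f.reverse.map (algebraMap R K)) := by
  have hX := RatFunc.X_ne_zero (K := K)
  let _ : Invertible (RatFunc.X : RatFunc K)⁻¹ := invertibleOfNonzero (inv_ne_zero hX)
  have h := eval₂_reverse_mul_pow (algebraMap R (RatFunc K)) (RatFunc.X : RatFunc K)⁻¹ f
  rw [invOf_eq_inv, inv_inv] at h
  rw [aeval_map_algebraMap, aeval_def, ← h, mul_assoc, ← mul_pow, inv_mul_cancel₀ hX, one_pow,
    mul_one, ← aeval_X_eq_algebraMap, aeval_map_algebraMap, aeval_def]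

/-- The residue at `∞` of a function with denominator `Δ` times a power of `x` is integral over `R`
if the leading coefficient of `Δ` is a unit. -/
lemma isIntegral_residue_infinity {R : Type*} [CommRing R] [Algebra R K]
    {Δ N : R[X]} {n : ℕ} (hlc : IsUnit Δ.leadingCoeff) {g : RatFunc K}
    (hg : algebraMap K[X] (RatFunc K) (Δ.map (algebraMap R K)) * RatFunc.X ^ n * g =
      algebraMap K[X] (RatFunc K) (N.map (algebraMap R K)))
    (hh : (invRat K (-(RatFunc.X * g))).denom.eval 0 ≠ 0) :
    IsIntegral R ((invRat K (-(RatFunc.X * g))).eval (RingHom.id K) 0) := by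
  have hX := RatFunc.X_ne_zero (K := K)
  obtain ⟨u, hu⟩ := hlc
  refine isIntegral_eval_of_mul_eq isIntegral_zero (m := N.natDegree + 1)
    (s := Δ.reverse.map (algebraMap R K)) (N := -(N.reverse * X ^ (Δ.natDegree + n)))
    ⟨algebraMap R K ↑u⁻¹, isIntegral_algebraMap, ?_⟩ ?_ hh
  · rw [← map_zero (algebraMap R K), eval_map_apply, ← coeff_zero_eq_eval_zero, coeff_zero_reverse,
      ← hu, ← map_mul, Units.mul_inv, map_one]
  · have h1 := congrArg (invRat K) hg
    rw [map_mul, map_mul, map_pow, invRat_X, invRat_algebraMap, invRat_algebraMap] at h1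
    rw [map_zero, sub_zero, map_mul, map_pow, RatFunc.algebraMap_X, Polynomial.map_neg,
      Polynomial.map_mul, Polynomial.map_pow, map_X, map_neg (algebraMap K[X] (RatFunc K)),
      map_mul (algebraMap K[X] (RatFunc K)), map_pow (algebraMap K[X] (RatFunc K)),
      RatFunc.algebraMap_X, ← aeval_X_inv_eq_reverse, ← aeval_X_inv_eq_reverse, ← h1,
      map_neg (invRat K), map_mul (invRat K), invRat_X, pow_add, pow_add, inv_pow]
    generalize aeval (RatFunc.X : RatFunc K)⁻¹ (Δ.map (algebraMap R K)) = a
    field_simp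

lemma exists_aeval_X_inv_mul_eq (f : RatFunc K) : ∃ a c : K[X], a ≠ 0 ∧
    aeval (RatFunc.X : RatFunc K)⁻¹ a * f = aeval (RatFunc.X : RatFunc K)⁻¹ c := by
  have hinv : invRat K (invRat K f) = f := by
    conv_lhs => rw [← RatFunc.num_div_denom f]
    rw [map_div₀, map_div₀, invRat_algebraMap, invRat_algebraMap, invRat_aeval_X_inv,
      invRat_aeval_X_inv, RatFunc.num_div_denom]
  refine ⟨(invRat K f).denom, (invRat K f).num, RatFunc.denom_ne_zero _, ?_⟩
  have h1 : algebraMap K[X] (RatFunc K) (invRat K f).denom * invRat K f =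
      algebraMap K[X] (RatFunc K) (invRat K f).num := by
    have hd := (map_ne_zero_iff _ (RatFunc.algebraMap_injective K)).2 (invRat K f).denom_ne_zero
    rw [mul_comm, eq_comm, ← div_eq_iff hd, RatFunc.num_div_denom]
  have h2 := congrArg (invRat K) h1
  rwa [map_mul, hinv, invRat_algebraMap, invRat_algebraMap] at h2

end Inversion

/-! ### The connection matrix of the basis at infinity -/

section InfinityConnection

variable {p : ℕ} [Fact p.Prime] {k : Type u} [Field k] [CharP k p]

lemma laurentToRat_toLaurent (f : (Zq p k)[X]) :
    laurentToRat p k (toLaurent f) = polyToRat p k f := by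
  rw [laurentToRat, LaurentPolynomial.eval₂_toLaurent, polyToRat_apply]
  induction f using Polynomial.induction_on' with
  | add f g hf hg => rw [eval₂_add, hf, hg, Polynomial.map_add, map_add]
  | monomial n a =>
    rw [eval₂_monomial, map_monomial, ← C_mul_X_pow_eq_monomial, map_mul, map_pow,
      RatFunc.algebraMap_X, RatFunc.algebraMap_C]
    rfl

lemma exists_laurentToRat_mul_X_pow (w : (Zq p k)[T;T⁻¹]) :
    ∃ n N, laurentToRat p k w * RatFunc.X ^ n = polyToRat p k N := by
  obtain ⟨n, N, h⟩ := LaurentPolynomial.exists_T_pow w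
  refine ⟨n, N, ?_⟩
  rw [← laurentToRat_toLaurent, h, map_mul]
  congr 1
  simp [laurentToRat]

variable {F : (Zq p k)[X][X]} [Fact (Irreducible (F.map (polyToRat p k)))]
  {D : Derivation (Qq p k) (FunField F) (FunField F)}

/-- Laurent polynomials over `ℤ_q` are stable under the derivation `d/dx`. -/
lemma exists_deriv_laurentToRat (hD : D (funX F) = 1) (w : (Zq p k)[T;T⁻¹]) :
    ∃ w', D (algebraMap (RatFunc (Qq p k)) (FunField F) (laurentToRat p k w)) =
      algebraMap (RatFunc (Qq p k)) (FunField F) (laurentToRat p k w') := by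
  induction w using LaurentPolynomial.induction_on' with
  | add f g hf hg =>
    obtain ⟨f', hf'⟩ := hf
    obtain ⟨g', hg'⟩ := hg
    exact ⟨f' + g', by simp only [map_add, hf', hg']⟩
  | C_mul_T n a =>
    have key : ∀ (n : ℤ) (a : Zq p k), algebraMap (RatFunc (Qq p k)) (FunField F)
        (laurentToRat p k (LaurentPolynomial.C a * LaurentPolynomial.T n)) =
        algebraMap (Qq p k) (FunField F) (algebraMap (Zq p k) (Qq p k) a) * funX F ^ n :=
      fun n a => by
        rw [laurentToRat, LaurentPolynomial.eval₂_C_mul_T, map_mul, RingHom.comp_apply,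
          ← IsScalarTower.algebraMap_apply, Units.val_zpow_eq_zpow_val, Units.val_mk0, map_zpow₀]
    refine ⟨LaurentPolynomial.C (a * n) * LaurentPolynomial.T (n - 1), ?_⟩
    have hz : D (funX F ^ n) = n • funX F ^ (n - 1) • D (funX F) :=
      Derivation.leibniz_zpow D (funX F) n
    rw [key, key, Derivation.leibniz, Derivation.map_algebraMap, hz, hD]
    simp only [map_mul, map_intCast, smul_eq_mul, zsmul_eq_mul]
    ring

/-- Some `x ^ n * Δ` is a denominator of the entry `(m, j)` of the connection matrix at infinity:
by Leibniz, the `ℤ_q[x, x⁻¹]`-lattice spanned by the powers of `y` is mapped by `Δ · d/dx` to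
itself, and the family at infinity is another basis of it. -/
lemma exists_discr_mul_X_pow_mul_eq (hD : D (funX F) = 1) (hF : F.Monic)
    {W : GL (Fin F.natDegree) (Zq p k)[T;T⁻¹]} {Δ : (Zq p k)[X]}
    {G Ginf : Matrix (Fin F.natDegree) (Fin F.natDegree) (RatFunc (Qq p k))}
    (hG : ∀ j, D (powerFamily F j) = ∑ i, G i j • powerFamily F i)
    (hΔ : ∀ i j, ∃ N, polyToRat p k Δ * G i j = polyToRat p k N)
    (hGinf : ∀ j, D (infinityFamily F W j) = ∑ i, Ginf i j • infinityFamily F W i)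
    (m j : Fin F.natDegree) :
    ∃ n N, polyToRat p k Δ * RatFunc.X ^ n * Ginf m j = polyToRat p k N := by
  choose N hN using hΔ
  choose w' hw' using exists_deriv_laurentToRat (F := F) (D := D) hD
  let v : Fin F.natDegree → (Zq p k)[T;T⁻¹] := fun l =>
    toLaurent Δ * w' (W.val l j) + ∑ i, W.val i j * toLaurent (N l i)
  have h1 : polyToRat p k Δ • D (infinityFamily F W j) =
      ∑ l, laurentToRat p k (v l) • powerFamily F l := by
    have h3 : D (infinityFamily F W j) = ∑ l, (laurentToRat p k (w' (W.val l j)) +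
        ∑ i, laurentToRat p k (W.val i j) * G l i) • powerFamily F l := by
      simp only [add_smul, Finset.sum_add_distrib, Finset.sum_smul]
      rw [Finset.sum_comm, ← Finset.sum_add_distrib, infinityFamily, map_sum]
      refine Finset.sum_congr rfl fun i _ => ?_
      rw [Algebra.smul_def, Derivation.leibniz, hw', hG, add_comm]
      simp only [smul_eq_mul, Finset.mul_sum, Algebra.smul_def, map_mul, mul_assoc]
      rw [mul_comm]
    rw [h3, Finset.smul_sum]
    refine Finset.sum_congr rfl fun l _ => ?_
    rw [smul_smul]
    congr 1
    simp only [v, map_add, map_mul, map_sum, laurentToRat_toLaurent, ← hN, mul_add,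
      Finset.mul_sum]
    congr 1
    exact Finset.sum_congr rfl fun i _ => by ring
  have h2 : ∑ i, (polyToRat p k Δ * Ginf i j) • infinityFamily F W i =
      ∑ i, laurentToRat p k (∑ l, W⁻¹.val i l * v l) • infinityFamily F W i := by
    simp only [mul_smul]
    rw [← Finset.smul_sum, ← hGinf, h1]
    simp only [map_sum, Finset.sum_smul]
    rw [Finset.sum_comm]
    refine Finset.sum_congr rfl fun l _ => ?_
    rw [powerFamily_eq_sum W l, Finset.smul_sum]
    exact Finset.sum_congr rfl fun i _ => by rw [smul_smul, map_mul, mul_comm]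
  have h4 := (linearIndependent_infinityFamily hF W).1
  have h5 : polyToRat p k Δ * Ginf m j = laurentToRat p k (∑ l, W⁻¹.val m l * v l) := by
    rw [← sub_eq_zero]
    refine Fintype.linearIndependent_iff.1 h4 (fun i => polyToRat p k Δ * Ginf i j -
      laurentToRat p k (∑ l, W⁻¹.val i l * v l)) ?_ m
    simp only [sub_smul, Finset.sum_sub_distrib]
    rw [h2, sub_self]
  obtain ⟨n, N', h6⟩ := exists_laurentToRat_mul_X_pow (∑ l, W⁻¹.val m l * v l)
  exact ⟨n, N', by rw [mul_right_comm, h5, h6]⟩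

end InfinityConnection

/-! ### Exponents at infinity -/

lemma eq_div_of_hasEigenvalue {K E : Type*} [Field K] [Field E] [Algebra K E] {d : ℕ}
    {M : Matrix (Fin d) (Fin d) K} {S : Multiset ℕ} (hM : aeval M (S.map (ramPoly K)).prod = 0)
    {μ : E} (hμ : Module.End.HasEigenvalue (Matrix.toLin' (M.map (algebraMap K E))) μ) :
    ∃ a e : ℕ, a < e ∧ μ = a / e := by
  have h1 : aeval (M.map (algebraMap K E)) (S.map (ramPoly K)).prod = 0 := by
    have h2 := aeval_algHom_apply (Algebra.ofId K E).mapMatrix M (S.map (ramPoly K)).prod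
    rw [hM, map_zero] at h2
    exact h2
  have h3 : aeval (Matrix.toLin' (M.map (algebraMap K E)))
      ((S.map (ramPoly K)).prod.map (algebraMap K E)) = 0 := by
    have h2 := aeval_algHom_apply (Matrix.toLinAlgEquiv' (R := E) (n := Fin d)).toAlgHom
      (M.map (algebraMap K E)) ((S.map (ramPoly K)).prod.map (algebraMap K E))
    rw [aeval_map_algebraMap _ (M.map _), h1, map_zero] at h2
    exact h2
  obtain ⟨v, hv⟩ := hμ.exists_hasEigenvector
  have h4 := Module.End.aeval_apply_of_hasEigenvector (p := (S.map (ramPoly K)).prod.map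
    (algebraMap K E)) hv
  rw [h3, LinearMap.zero_apply, eq_comm, smul_eq_zero, or_iff_left hv.2,
    Polynomial.map_multiset_prod, eval_multiset_prod, Multiset.prod_eq_zero_iff, Multiset.map_map,
    Multiset.map_map] at h4
  obtain ⟨e, -, he⟩ := Multiset.mem_map.1 h4
  rw [Function.comp_apply, Function.comp_apply, ramPoly, Polynomial.map_prod, eval_prod,
    Finset.prod_eq_zero_iff] at he
  obtain ⟨a, ha, he⟩ := he
  refine ⟨a, e, Finset.mem_range.1 ha, ?_⟩
  simpa [sub_eq_zero] using he

lemma exists_isIntegral_aeval_mul_of_span {k₀ K L : Type*} [Field k₀] [Field K] [Field L]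
    [Algebra k₀ K] [Algebra K L] [Algebra k₀ L] [IsScalarTower k₀ K L] {τ : K}
    (hτ : ∀ f : K, ∃ a c : k₀[X], a ≠ 0 ∧ aeval τ a * f = aeval τ c) {d : ℕ} {b : Fin d → L}
    (hb : ⊤ ≤ Submodule.span K (Set.range b))
    (hint : ∀ j, IsIntegral (Algebra.adjoin k₀ {algebraMap K L τ}) (b j)) (z : L) :
    ∃ a : k₀[X], a ≠ 0 ∧
      IsIntegral (Algebra.adjoin k₀ {algebraMap K L τ}) (aeval (algebraMap K L τ) a * z) := by
  have hz := hb (Submodule.mem_top (x := z))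
  induction hz using Submodule.span_induction with
  | mem z hz =>
    obtain ⟨j, rfl⟩ := hz
    exact ⟨1, one_ne_zero, by rw [map_one, one_mul]; exact hint j⟩
  | zero => exact ⟨1, one_ne_zero, by rw [mul_zero]; exact isIntegral_zero⟩
  | add z z' _ _ h h' =>
    obtain ⟨a, ha, hz⟩ := h
    obtain ⟨a', ha', hz'⟩ := h'
    refine ⟨a * a', mul_ne_zero ha ha', ?_⟩
    rw [map_mul, mul_add]
    refine IsIntegral.add ?_ ?_
    · rw [mul_right_comm]
      exact hz.mul (isIntegral_aeval _ _)
    · rw [mul_assoc]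
      exact (isIntegral_aeval _ _).mul hz'
  | smul f z _ h =>
    obtain ⟨a, ha, hz⟩ := h
    obtain ⟨a', c, ha', hc⟩ := hτ f
    refine ⟨a' * a, mul_ne_zero ha' ha, ?_⟩
    have h1 := congrArg (algebraMap K L) hc
    rw [map_mul, ← aeval_algebraMap_apply, ← aeval_algebraMap_apply] at h1
    rw [map_mul, Algebra.smul_def, mul_mul_mul_comm, h1]
    exact (isIntegral_aeval _ _).mul hz

section InfinityExponents

variable {p : ℕ} [Fact p.Prime] {k : Type u} [Field k] [CharP k p]
  {F : (Zq p k)[X][X]} [Fact (Irreducible (F.map (polyToRat p k)))]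

lemma aeval_algebraMap_X_inv (f : (Qq p k)[X]) :
    aeval (algebraMap (RatFunc (Qq p k)) (FunField F) RatFunc.X⁻¹) f =
      algebraMap (RatFunc (Qq p k)) (FunField F) (aeval (RatFunc.X : RatFunc (Qq p k))⁻¹ f) :=
  aeval_algebraMap_apply _ _ _

lemma integralBasisData_infinityFamily (hF : F.Monic) {W : GL (Fin F.natDegree) (Zq p k)[T;T⁻¹]}
    (hW : IsIntegralBasisAtInfinity F (infinityFamily F W)) :
    IntegralBasisData (Qq p k) (algebraMap (RatFunc (Qq p k)) (FunField F) RatFunc.X⁻¹)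
      (infinityFamily F W) where
  transcendental := by
    refine transcendental_iff.2 fun f hf => ?_
    rw [aeval_algebraMap_X_inv, map_eq_zero] at hf
    exact transcendental_iff.1 transcendental_X_inv f hf
  frac z := by
    refine exists_isIntegral_aeval_mul_of_span exists_aeval_X_inv_mul_eq
      (linearIndependent_infinityFamily hF W).2 (fun j => ?_) z
    have h1 : infinityFamily F W j ∈
        Submodule.span (invXSubalgebra F) (Set.range (infinityFamily F W)) :=
      Submodule.subset_span ⟨j, rfl⟩
    rw [hW.2] at h1
    exact h1
  indep := hW.1
  span := hW.2

/-- With `t = 1/x`, the derivation `-x · d/dx` is `t · d/dt`, so that the matrix of `t · d/dt` at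
`t = 0` in the integral basis is the residue matrix of the connection matrix at infinity. -/
lemma exists_residueMatrix_infinity [CharZero (Qq p k)] (hF : F.Monic)
    {W : GL (Fin F.natDegree) (Zq p k)[T;T⁻¹]}
    (hW : IsIntegralBasisAtInfinity F (infinityFamily F W))
    {D : Derivation (Qq p k) (FunField F) (FunField F)} (hD : D (funX F) = 1)
    {Ginf : Matrix (Fin F.natDegree) (Fin F.natDegree) (RatFunc (Qq p k))}
    (hG : ∀ j, D (infinityFamily F W j) = ∑ i, Ginf i j • infinityFamily F W i) :
    ∃ M : Matrix (Fin F.natDegree) (Fin F.natDegree) (Qq p k),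
      (∃ S : Multiset ℕ, aeval M (S.map (ramPoly (Qq p k))).prod = 0) ∧
      ∀ i j, ∃ s n : (Qq p k)[X], s.eval 0 ≠ 0 ∧ n.eval 0 = s.eval 0 * M i j ∧
        aeval (RatFunc.X : RatFunc (Qq p k))⁻¹ s * -(RatFunc.X * Ginf i j) =
          aeval (RatFunc.X : RatFunc (Qq p k))⁻¹ n := by
  have hX : funX F ≠ 0 := by simpa using RatFunc.X_ne_zero
  have hδ : (-(funX F) • D) (algebraMap (RatFunc (Qq p k)) (FunField F) RatFunc.X⁻¹) =
      algebraMap (RatFunc (Qq p k)) (FunField F) RatFunc.X⁻¹ := by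
    have h1 : D (funX F)⁻¹ = -(funX F)⁻¹ ^ 2 • D (funX F) := Derivation.leibniz_inv D (funX F)
    rw [map_inv₀, Derivation.smul_apply, h1, hD, smul_eq_mul, smul_eq_mul]
    field_simp
  obtain ⟨M, hM, hS⟩ := exists_matrix_of_integralBasis (integralBasisData_infinityFamily hF hW) hδ
  refine ⟨M, hS, fun i j => ?_⟩
  obtain ⟨s, n, hs, h1, hn⟩ := hM j
  refine ⟨s, n i, hs, hn i, ?_⟩
  rw [← sub_eq_zero]
  refine Fintype.linearIndependent_iff.1 (linearIndependent_infinityFamily hF W).1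
    (fun i => aeval (RatFunc.X : RatFunc (Qq p k))⁻¹ s * -(RatFunc.X * Ginf i j) -
      aeval (RatFunc.X : RatFunc (Qq p k))⁻¹ (n i)) ?_ i
  simp only [sub_smul, Finset.sum_sub_distrib]
  rw [sub_eq_zero]
  simp only [aeval_algebraMap_X_inv] at h1
  simp only [Algebra.smul_def]
  rw [← h1, Derivation.smul_apply, hG, smul_eq_mul, Finset.mul_sum, Finset.mul_sum]
  refine Finset.sum_congr rfl fun i _ => ?_
  rw [Algebra.smul_def, map_mul, map_neg, map_mul]
  ring

end InfinityExponents

/-! ### Exponents of the lift -/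

section Exponents

lemma IsMonicLift.natDegree_pos {p : ℕ} [Fact p.Prime] {k : Type u} [Field k]
    {Q : k[X][X]} {F : (Zq p k)[X][X]} (hF : IsMonicLift Q F) (hQ : Irreducible Q) :
    0 < F.natDegree := by
  refine Nat.pos_of_ne_zero fun h => hQ.not_isUnit ?_
  rw [← hF.reduction, hF.monic.natDegree_eq_zero.1 h, Polynomial.map_one]
  exact isUnit_one

/-- The discriminant does not vanish modulo `p`, since the reduction of `F` is separable. -/
lemma IsMonicLift.map_discr_ne_zero {p : ℕ} [Fact p.Prime] {k : Type u}
    [Field k] {Q : k[X][X]} {F : (Zq p k)[X][X]} (hF : IsMonicLift Q F)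
    (hQ : Irreducible Q) (hsep : (Q.map (algebraMap k[X] (RatFunc k))).Separable) :
    F.discr.map (WittVector.constantCoeff : Zq p k →+* k) ≠ 0 :=
  GaussManin.map_discr_ne_zero hF.monic (hF.natDegree_pos hQ)
    (mapRingHom (WittVector.constantCoeff : Zq p k →+* k)) (algebraMap k[X] (RatFunc k))
    (by rwa [hF.reduction])

variable {p : ℕ} [Fact p.Prime] {k : Type u} [Field k] [CharP k p] [PerfectRing k p]

lemma isPAdicallyIntegralRatInUnitInterval_div {a e : ℕ} (h : a < e)
    (hint : IsIntegral (Zq p k) ((a : QqBar p k) / e)) :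
    IsPAdicallyIntegralRatInUnitInterval p ((a : QqBar p k) / e) := by
  have := charZero_Qq p k
  have : CharZero (QqBar p k) :=
    charZero_of_injective_algebraMap (algebraMap (Qq p k) (QqBar p k)).injective
  have he : (0 : ℚ) < e := by exact_mod_cast (Nat.zero_le a).trans_lt h
  refine ⟨(a : ℚ) / e, by push_cast; rfl, by positivity, ?_,
    exists_padicInt_of_isIntegral (k := k) ?_⟩
  · rw [div_lt_one he]; exact_mod_cast h
  · push_cast; exact hint

/-- Reduction modulo `p` is injective on the roots of the discriminant, and none of them reduces
to `∞`. -/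
lemma GoodLift.isCoprime_and_isUnit_and_dvd_pow {F : (Zq p k)[X][X]} {r : (Zq p k)[X]}
    (h : GoodLift F r) (hr : IsSquarefreePart F.discr r)
    (hΔ : F.discr.map (WittVector.constantCoeff : Zq p k →+* k) ≠ 0) :
    IsCoprime r (derivative r) ∧ IsUnit r.leadingCoeff ∧ ∃ n, F.discr ∣ r ^ n := by
  have := charZero_Zq p k
  have hΔ0 : F.discr ≠ 0 := fun h0 => hΔ (by rw [h0, Polynomial.map_zero])
  have hsq := hr.squarefree hΔ0
  obtain ⟨D, hD, hDr⟩ := h.line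
  refine ⟨ClosedInP1.isCoprime_derivative hD hDr hsq.isRadical,
    ClosedInP1.isUnit_leadingCoeff hD hDr hsq.ne_zero, hr.exists_dvd_pow hΔ0 ?_⟩
  rintro c hc ⟨f, hf⟩
  have hc0 : (WittVector.constantCoeff : Zq p k →+* k) c = 0 := by
    by_contra h0
    exact hc (WittVector.isUnit_of_coeff_zero_ne_zero c h0)
  rw [hf, Polynomial.map_mul, map_C, hc0, C_0, zero_mul] at hΔ
  exact hΔ rfl

variable {F : (Zq p k)[X][X]} [Fact (Irreducible (F.map (polyToRat p k)))] {r : (Zq p k)[X]} {n : ℕ}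

/-- The exponents at a finite point: they are of the form `a / e` by smoothness, and integral
because the discriminant has distinct roots modulo `p`. -/
lemma exponents_finite (hF : F.Monic) (h0 : 0 < F.natDegree) (hΔ : F.discr ≠ 0)
    (hr : IsCoprime r (derivative r)) (hlc : IsUnit r.leadingCoeff) (hΔr : F.discr ∣ r ^ n)
    (hsm : SmoothZeroLocus F) {G : Matrix (Fin F.natDegree) (Fin F.natDegree) (RatFunc (Qq p k))}
    (hG : IsConnectionMatrix F (powerFamily F) G) (x₀ : QqBar p k) :
    HasAtMostSimplePole (G.map (ratFuncBaseChange (Qq p k) (QqBar p k))) x₀ ∧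
      ∀ μ ∈ exponents (G.map (ratFuncBaseChange (Qq p k) (QqBar p k))) x₀,
        IsPAdicallyIntegralRatInUnitInterval p μ := by
  have := charZero_Qq p k
  have : CharZero (QqBar p k) :=
    charZero_of_injective_algebraMap (algebraMap (Qq p k) (QqBar p k)).injective
  obtain ⟨D, hD, hDG⟩ := exists_derivation (F := F)
  have hrel := powerRel_of_deriv hD ((hDG _ _).1 hG)
  set f := mapRingHom (algebraMap (Zq p k) (QqBar p k)) with hf
  have hrel' := hrel.map (algebraMap (Zq p k) (QqBar p k))
    (ratFuncBaseChange (Qq p k) (QqBar p k)) ratFuncBaseChange_comp_polyToRat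
  have hFd : (F.map f).natDegree = F.natDegree := hF.natDegree_map f
  have hinj : Function.Injective (algebraMap (Zq p k) (QqBar p k)) := by
    rw [IsScalarTower.algebraMap_eq (Zq p k) (Qq p k) (QqBar p k)]
    exact (algebraMap (Qq p k) (QqBar p k)).injective.comp (IsFractionRing.injective _ _)
  have hcop := isCoprime_map_derivative hF h0
    ((algebraMap (QqBar p k)[X] (RatFunc (QqBar p k))).comp f)
    ((map_ne_zero_iff (algebraMap (QqBar p k)[X] (RatFunc (QqBar p k)))
      (RatFunc.algebraMap_injective _)).2 ((map_ne_zero_iff f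
      (Polynomial.map_injective _ hinj)).2 hΔ))
  rw [← Polynomial.map_map, ← Polynomial.map_map, ← derivative_map] at hcop
  obtain ⟨hpole, hexp⟩ := finite_exponents (hF.map f) hFd (x₀ := x₀)
    (fun y₁ hy => by
      have := hsm x₀ y₁ hy
      rwa [derivative_eval_C] at this) hcop hrel'
  refine ⟨hpole, fun μ hμ => ?_⟩
  obtain ⟨a, e, hae, rfl⟩ := hexp μ hμ
  refine isPAdicallyIntegralRatInUnitInterval_div hae (isIntegral_of_hasEigenvalue ?_ hμ)
  intro i j
  obtain ⟨N, hN⟩ := exists_discr_mul_eq hF h0 hΔ hrel i j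
  refine isIntegral_residue hr hlc hΔr (N := N) ?_ (hpole i j)
  have h1 := congrArg (ratFuncBaseChange (Qq p k) (QqBar p k)) hN
  rw [map_mul] at h1
  have h2 := fun q => RingHom.congr_fun (ratFuncBaseChange_comp_polyToRat (p := p) (k := k)) q
  simp only [RingHom.comp_apply] at h2
  rwa [h2, h2] at h1

/-- The exponents at infinity: they are of the form `a / e` because the basis is integral, and
integral because the discriminant has a unit as leading coefficient. -/
lemma exponents_infinity (hF : F.Monic) (h0 : 0 < F.natDegree) (hΔ : F.discr ≠ 0)
    (hlc : IsUnit r.leadingCoeff) (hΔr : F.discr ∣ r ^ n)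
    {W : GL (Fin F.natDegree) (Zq p k)[T;T⁻¹]}
    (hW : IsIntegralBasisAtInfinity F (infinityFamily F W))
    {Ginf : Matrix (Fin F.natDegree) (Fin F.natDegree) (RatFunc (Qq p k))}
    (hGinf : IsConnectionMatrix F (infinityFamily F W) Ginf) :
    HasAtMostSimplePole (substInv (Ginf.map (ratFuncBaseChange (Qq p k) (QqBar p k)))) 0 ∧
      ∀ μ ∈ exponents (substInv (Ginf.map (ratFuncBaseChange (Qq p k) (QqBar p k)))) 0,
        IsPAdicallyIntegralRatInUnitInterval p μ := by
  have := charZero_Qq p k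
  obtain ⟨D, hD, hDG⟩ := exists_derivation (F := F)
  have hpow := linearIndependent_powerFamily hF
  obtain ⟨G, hG, -⟩ := existsUnique_isConnectionMatrix hpow.1 hpow.2
  obtain ⟨M, ⟨S, hS⟩, hM⟩ := exists_residueMatrix_infinity hF hW hD ((hDG _ _).1 hGinf)
  have hres : ∀ i j, (invRat (QqBar p k) (-(RatFunc.X *
      ratFuncBaseChange (Qq p k) (QqBar p k) (Ginf i j)))).denom.eval 0 ≠ 0 ∧
      (invRat (QqBar p k) (-(RatFunc.X * ratFuncBaseChange (Qq p k) (QqBar p k)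
        (Ginf i j)))).eval (RingHom.id (QqBar p k)) 0 = algebraMap (Qq p k) (QqBar p k) (M i j) :=
    fun i j => by
      obtain ⟨s, n, hs, hn, h⟩ := hM i j
      exact substInv_regular hs hn h
  have hmat : residueMatrix (substInv (Ginf.map (ratFuncBaseChange (Qq p k) (QqBar p k)))) 0 =
      M.map (algebraMap (Qq p k) (QqBar p k)) := by
    ext i j
    rw [residueMatrix, substInv, Matrix.map_apply, Matrix.map_apply, Matrix.map_apply,
      Matrix.map_apply, substInv_residue, (hres i j).2]
  refine ⟨fun i j => ?_, fun μ hμ => ?_⟩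
  · rw [substInv, Matrix.map_apply, Matrix.map_apply, substInv_residue]
    exact (hres i j).1
  rw [exponents, Set.mem_ofPred_eq, hmat] at hμ
  obtain ⟨a, e, hae, rfl⟩ := eq_div_of_hasEigenvalue hS hμ
  refine isPAdicallyIntegralRatInUnitInterval_div hae (isIntegral_of_hasEigenvalue ?_ hμ)
  intro i j
  obtain ⟨m, N, hN⟩ := exists_discr_mul_X_pow_mul_eq hD hF ((hDG _ _).1 hG)
    (exists_discr_mul_eq hF h0 hΔ (powerRel_of_deriv hD ((hDG _ _).1 hG))) ((hDG _ _).1 hGinf) i j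
  rw [Matrix.map_apply, ← (hres i j).2]
  have hlcΔ : IsUnit F.discr.leadingCoeff := by
    obtain ⟨f, hf⟩ := hΔr
    have h1 := congrArg leadingCoeff hf
    rw [leadingCoeff_pow, leadingCoeff_mul] at h1
    exact isUnit_of_mul_isUnit_left (h1 ▸ hlc.pow n)
  refine isIntegral_residue_infinity (n := m) (N := N) hlcΔ ?_ (hres i j).1
  have h1 := congrArg (ratFuncBaseChange (Qq p k) (QqBar p k)) hN
  rw [map_mul, map_mul, map_pow, ratFuncBaseChange_X] at h1
  have h2 := fun q => RingHom.congr_fun (ratFuncBaseChange_comp_polyToRat (p := p) (k := k)) q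
  simp only [RingHom.comp_apply] at h2
  rwa [h2, h2] at h1

end Exponents

end GaussManin

end

theorem mainTheorem9 (p : ℕ) [Fact p.Prime] (k : Type u) [Field k] [Finite k] [CharP k p]
    (Q : k[X][X]) (hQirr : Irreducible Q) (hQmonic : Q.Monic)
    (hQsep : (Q.map (algebraMap k[X] (RatFunc k))).Separable)
    (F : (GaussManin.Zq p k)[X][X]) (hF : GaussManin.IsMonicLift Q F)
    (r : (GaussManin.Zq p k)[X]) (hr : GaussManin.IsSquarefreePart F.discr r)
    (hgood : GaussManin.GoodLift F r)
    (hsmooth : GaussManin.SmoothZeroLocus F)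
    (W : GL (Fin F.natDegree) (GaussManin.Zq p k)[T;T⁻¹])
    (hW : GaussManin.IsIntegralBasisAtInfinity F (GaussManin.infinityFamily F W)) :
    (∃! G : Matrix (Fin F.natDegree) (Fin F.natDegree) (RatFunc (GaussManin.Qq p k)),
      GaussManin.IsConnectionMatrix F (GaussManin.powerFamily F) G) ∧
    (∃! Ginf : Matrix (Fin F.natDegree) (Fin F.natDegree) (RatFunc (GaussManin.Qq p k)),
      GaussManin.IsConnectionMatrix F (GaussManin.infinityFamily F W) Ginf) ∧
    (∀ G : Matrix (Fin F.natDegree) (Fin F.natDegree) (RatFunc (GaussManin.Qq p k)),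
      GaussManin.IsConnectionMatrix F (GaussManin.powerFamily F) G →
      ∀ x₀ : GaussManin.QqBar p k,
        GaussManin.HasAtMostSimplePole
          (G.map (GaussManin.ratFuncBaseChange (GaussManin.Qq p k) (GaussManin.QqBar p k))) x₀ ∧
        ∀ μ ∈ GaussManin.exponents
          (G.map (GaussManin.ratFuncBaseChange (GaussManin.Qq p k) (GaussManin.QqBar p k))) x₀,
          GaussManin.IsPAdicallyIntegralRatInUnitInterval p μ) ∧
    (∀ Ginf : Matrix (Fin F.natDegree) (Fin F.natDegree) (RatFunc (GaussManin.Qq p k)),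
      GaussManin.IsConnectionMatrix F (GaussManin.infinityFamily F W) Ginf →
        GaussManin.HasAtMostSimplePole
          (GaussManin.substInv (Ginf.map
            (GaussManin.ratFuncBaseChange (GaussManin.Qq p k) (GaussManin.QqBar p k)))) 0 ∧
        ∀ μ ∈ GaussManin.exponents
          (GaussManin.substInv (Ginf.map
            (GaussManin.ratFuncBaseChange (GaussManin.Qq p k) (GaussManin.QqBar p k)))) 0,
          GaussManin.IsPAdicallyIntegralRatInUnitInterval p μ) := by
  have : PerfectRing k p := inferInstance
  have : Fact (Irreducible (F.map (GaussManin.polyToRat p k))) := ⟨hF.irreducible hQirr⟩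
  have h0 := hF.natDegree_pos hQirr
  have hΔk := hF.map_discr_ne_zero hQirr hQsep
  have hΔ : F.discr ≠ 0 := fun h => hΔk (by rw [h, Polynomial.map_zero])
  obtain ⟨hcop, hlc, n, hΔr⟩ := hgood.isCoprime_and_isUnit_and_dvd_pow hr hΔk
  have hpow := GaussManin.linearIndependent_powerFamily hF.monic
  have hinf := GaussManin.linearIndependent_infinityFamily hF.monic W
  exact ⟨GaussManin.existsUnique_isConnectionMatrix hpow.1 hpow.2,
    GaussManin.existsUnique_isConnectionMatrix hinf.1 hinf.2,
    fun G hG x₀ => GaussManin.exponents_finite hF.monic h0 hΔ hcop hlc hΔr hsmooth hG x₀,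
    fun Ginf hGinf => GaussManin.exponents_infinity hF.monic h0 hΔ hlc hΔr hW hGinf⟩
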